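/- Let $k$ be an algebraically closed field of characteristic $0$, let $A=k[X,Y]$, and let $f\in A$ be an irreducible polynomial with coordinate ring $R=A/(f)$ and function field $k(f)=\mathrm{Frac}(R)$. A place of $f$ is a valuation ring $V\subsetneq k(f)$ with $k\subset V$; it is a place at infinity if $R\not\subset V$, and a branch at finite distance if $R\subset V$. A branch at finite distance with valuation ring $V$ and maximal ideal $\mathfrak m_V$ is called singular (cuspidal) if $\mathfrak m_V\cap R\subset \mathfrak m_V^2$. Suppose that we are in Situation 2, that is: * $f$ has exactly one place at infinity; * $\mu(f;A)=\nu(f)+1$, where $\mu(f;A)$ is the length of $A/(f_X,f_Y)$ and $\nu(f)$ is the length of $A/(f,f_X,f_Y)$; * $n=\deg_Y f=4$ and $m=\deg_X f=3$. We say that a curve $g\in A$ has the parametric form $x=u(t),\ y=v(t)$, with $u,v\in k[t]$, if the kernel of the $k$-algebra map $A\to k[t]$, $X\mapsto u$, $Y\mapsto v$, is $(g)$ and $k(u,v)=k(t)$. Then: 1. If $f$ has at least one singular branch at finite distance, there are a $k$-algebra automorphism $\sigma$ of $A$ and $a\in\{0,-8,-9\}$ such that $\sigma(f)$ has the parametric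 form $$x=t^4+at^2,\qquad y=t^3-3t^2.$$ 2. If $f$ has no singular branch at finite distance, there are a $k$-algebra automorphism $\sigma$ of $A$ and $a,b\in k$ with $a=-1$ and $b\ne\pm1$ such that $\sigma(f)$ has the parametric form $$x=(t^2-1)(t^2+a),\qquad y=(t^2-1)(t+b).$$ -/

import Mathlib

namespace PlaneCurve

variable {k : Type*} [Field k]

/-- The coordinate ring `R = k[X, Y] / (f)`; the coordinates are `X = X 0` and `Y = X 1`. -/
abbrev CoordRing (f : MvPolynomial (Fin 2) k) : Type _ :=
  MvPolynomial (Fin 2) k ⧸ Ideal.span {f}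

instance (f : MvPolynomial (Fin 2) k) [hf : Fact (Irreducible f)] : IsDomain (CoordRing f) :=
  (Ideal.Quotient.isDomain_iff_prime _).2
    ((Ideal.span_singleton_prime hf.out.ne_zero).2 hf.out.prime)

/-- The function field `k(f)` of the irreducible curve `f = 0`. -/
abbrev FunctionField (f : MvPolynomial (Fin 2) k) [Fact (Irreducible f)] : Type _ :=
  FractionRing (CoordRing f)

/-- A valuation ring of the function field over `k` (a place of the curve): it contains `k` and is
not the whole field. -/
def IsPlace (f : MvPolynomial (Fin 2) k) [Fact (Irreducible f)]
    (V : ValuationSubring (FunctionField f)) : Prop :=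
  (∀ c : k, algebraMap k (FunctionField f) c ∈ V) ∧ V ≠ ⊤

/-- A branch at finite distance: a place whose valuation ring contains the coordinate ring. -/
def IsFiniteBranch (f : MvPolynomial (Fin 2) k) [Fact (Irreducible f)]
    (V : ValuationSubring (FunctionField f)) : Prop :=
  IsPlace f V ∧ ∀ r : CoordRing f, algebraMap (CoordRing f) (FunctionField f) r ∈ V

/-- A place at infinity: a place whose valuation ring does not contain the coordinate ring. -/
def IsPlaceAtInfinity (f : MvPolynomial (Fin 2) k) [Fact (Irreducible f)]
    (V : ValuationSubring (FunctionField f)) : Prop :=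
  IsPlace f V ∧ ¬ ∀ r : CoordRing f, algebraMap (CoordRing f) (FunctionField f) r ∈ V

/-- The curve has exactly one place at infinity. -/
def HasOnePlaceAtInfinity (f : MvPolynomial (Fin 2) k) [Fact (Irreducible f)] : Prop :=
  ∃! V : ValuationSubring (FunctionField f), IsPlaceAtInfinity f V

/-- A singular (cuspidal) branch at finite distance: a branch along which every element of the
coordinate ring that vanishes at the centre of the branch has order at least two. -/
def IsSingularBranch (f : MvPolynomial (Fin 2) k) [Fact (Irreducible f)]
    (V : ValuationSubring (FunctionField f)) : Prop :=
  IsFiniteBranch f V ∧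
    ∀ (r : CoordRing f) (h : algebraMap (CoordRing f) (FunctionField f) r ∈ V),
      (⟨algebraMap (CoordRing f) (FunctionField f) r, h⟩ : V) ∈ IsLocalRing.maximalIdeal V →
      (⟨algebraMap (CoordRing f) (FunctionField f) r, h⟩ : V) ∈ IsLocalRing.maximalIdeal V ^ 2

/-- The ideal `J_f = (f_X, f_Y)` of `k[X, Y]`. -/
noncomputable def jacobianIdeal (f : MvPolynomial (Fin 2) k) : Ideal (MvPolynomial (Fin 2) k) :=
  Ideal.span {MvPolynomial.pderiv 0 f, MvPolynomial.pderiv 1 f}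

/-- The Milnor number of the pencil `(f - a)`, `a ∈ k`: the length of `A / (f_X, f_Y)`. -/
noncomputable def milnorPencil (f : MvPolynomial (Fin 2) k) : ℕ∞ :=
  Module.length (MvPolynomial (Fin 2) k) (MvPolynomial (Fin 2) k ⧸ jacobianIdeal f)

/-- The affine Tjurina number of `f`: the length of `A / (f, f_X, f_Y)`. -/
noncomputable def tjurina (f : MvPolynomial (Fin 2) k) : ℕ∞ :=
  Module.length (MvPolynomial (Fin 2) k)
    (MvPolynomial (Fin 2) k ⧸ (Ideal.span {f} ⊔ jacobianIdeal f))

/-- A curve with one place at infinity, `μ(f; A) = ν(f) + 1`, and degrees `n = deg_Y f = 4`,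
`m = deg_X f = 3`. -/
structure IsSituationTwo (f : MvPolynomial (Fin 2) k) [Fact (Irreducible f)] : Prop where
  onePlace : HasOnePlaceAtInfinity f
  milnor_eq : milnorPencil f = tjurina f + 1
  degree_Y : MvPolynomial.degreeOf 1 f = 4
  degree_X : MvPolynomial.degreeOf 0 f = 3

/-- `x = u(t)`, `y = v(t)` is a parametric form of the curve `g = 0`: the polynomials vanishing on
the parametrized curve are the multiples of `g`, and the parametrization is birational, that is,
`k(u, v) = k(t)`. -/
def IsParametrizedBy (g : MvPolynomial (Fin 2) k) (u v : Polynomial k) : Prop :=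
  RingHom.ker (MvPolynomial.aeval ![u, v] : MvPolynomial (Fin 2) k →ₐ[k] Polynomial k)
      = Ideal.span {g} ∧
    IntermediateField.adjoin k
      {algebraMap (Polynomial k) (RatFunc k) u, algebraMap (Polynomial k) (RatFunc k) v} = ⊤

end PlaneCurve

/-! At the unique place at infinity, norms over `k(x)` give `v(x)^3 = v(y)^4`. Since `f` vanishes in
the function field, no monomial of `f` can strictly dominate there, so the Newton polygon lies below
the segment from `X^3` to `Y^4` (`newton_polygon`). An affine change of coordinates then makes `f`,
up to a constant, a member of the unfolding of the E6 singularity `X^3 + Y^4` with parameters `a, b,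
c, d, e, g`.

Let `J` be the Jacobian ideal. The Milnor algebra `A/J` of such a member has the basis `X^i Y^j`
with `i < 2`, `j < 3`. The condition `μ = ν + 1` says that `f` generates a simple submodule of
`A/J`: `f ∉ J`, while `(X - α) f` and `(Y - β) f` lie in `J` for some point `(α, β)`
(`isRankOne_of_length`). Expanding these products in the basis gives polynomial equations which
force `a ≠ 0`, express the other parameters through `a, α, β`, and leave four solutions up to
weighted scaling (`IsRankOne.unfolding_cases`).

Each solution is a curve with an explicit polynomial parametrization: `(t^4 + l t^2, t^3 - 3 t^2)`
with `l = 0, -8, -9`, or `((t^2 - 1)^2, t (t^2 - 1))`. Their singularities are A4 + A1, 2 A2 + A1,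
D5 and A5, the diagrams obtained from E6 by deleting one vertex.

The first three have a cusp at `t = 0`, because `t^2` divides both coordinates
(`exists_isSingularBranch`); the last is an immersion, so has no singular branch
(`not_isSingularBranch`). Thus the presence of a singular branch decides which form occurs. -/

section

/-! ### Norms and valuation rings with a unique extension -/

open Polynomial

/-- An element lying in every valuation ring that contains the image of `R` is integral over `R`. -/
theorem isIntegral_of_forall_mem_valuationSubring {R K : Type*} [CommRing R] [Field K] [Algebra R K]
    (z : K) (h : ∀ W : ValuationSubring K, (∀ r, algebraMap R K r ∈ W) → z ∈ W) :
    IsIntegral R z := by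
  by_contra hz
  have hz' : z ∉ (integralClosure R K).toSubring := hz
  obtain ⟨V, hV, hzV⟩ := Subring.exists_le_valuationSubring_of_isIntegrallyClosedIn hz'
  exact hzV (h V fun r => hV ((integralClosure R K).algebraMap_mem r))

/-- The norm is a power of the constant coefficient of the minimal polynomial, up to sign. -/
theorem norm_eq_coeff_zero_minpoly_pow {F K : Type*} [Field F] [Field K] [Algebra F K]
    [FiniteDimensional F K] (w : K) :
    ∃ e, 0 < e ∧ (minpoly F w).natDegree * e = Module.finrank F K ∧
      Algebra.norm F w =
        ((-1) ^ (minpoly F w).natDegree * (minpoly F w).coeff 0) ^ e := by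
  have hw : IsIntegral F w := Algebra.IsIntegral.isIntegral w
  refine ⟨Module.finrank (IntermediateField.adjoin F {w}) K, Module.finrank_pos, ?_, ?_⟩
  · rw [← IntermediateField.adjoin.finrank hw, Module.finrank_mul_finrank]
  · rw [Algebra.norm_eq_norm_adjoin]
    congr 1
    rw [← IntermediateField.adjoin.powerBasis_gen hw, Algebra.PowerBasis.norm_gen_eq_coeff_zero_minpoly,
      IntermediateField.adjoin.powerBasis_gen, IntermediateField.adjoin.powerBasis_dim,
      IntermediateField.minpoly_gen]

theorem ValuationSubring.valuation_eq_one_of_mem_of_inv_mem {K : Type*} [Field K]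
    (V : ValuationSubring K) {w : K} (h0 : w ≠ 0) (h1 : w ∈ V) (h2 : w⁻¹ ∈ V) :
    V.valuation w = 1 := by
  refine le_antisymm ((V.valuation_le_one_iff w).2 h1) ?_
  have := (V.valuation_le_one_iff _).2 h2
  rw [map_inv₀] at this
  exact (inv_le_one₀ (zero_lt_iff.2 ((Valuation.ne_zero_iff _).2 h0))).1 this

/-- The hypothesis `hV` puts `w` in every valuation ring of `K` above `O = V ∩ F`, so `w` is
integral over `O`. As `O` is integrally closed, the minimal polynomial over `F` already has
coefficients in `O`. -/
theorem ValuationSubring.minpoly_coeff_mem {F K : Type*} [Field F] [Field K] [Algebra F K]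
    (V : ValuationSubring K)
    (hV : ∀ W : ValuationSubring K,
      (∀ g : F, algebraMap F K g ∈ V → algebraMap F K g ∈ W) → V ≤ W)
    {w : K} (hw : w ∈ V) (i : ℕ) : algebraMap F K ((minpoly F w).coeff i) ∈ V := by
  let O : ValuationSubring F := V.comap (algebraMap F K)
  let : Algebra O K := ((algebraMap F K).comp O.subtype).toAlgebra
  have : IsScalarTower O F K := IsScalarTower.of_algebraMap_eq fun _ => rfl
  have hint : IsIntegral O w := by
    refine isIntegral_of_forall_mem_valuationSubring w fun W hW => hV W (fun g hg => ?_) hw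
    exact hW ⟨g, hg⟩
  rw [minpoly.isIntegrallyClosed_eq_field_fractions' F hint, coeff_map]
  exact ((minpoly O w).coeff i).2

theorem ValuationSubring.inv_mem_of_norm {F K : Type*} [Field F] [Field K] [Algebra F K]
    [FiniteDimensional F K] (V : ValuationSubring K)
    (hV : ∀ W : ValuationSubring K,
      (∀ g : F, algebraMap F K g ∈ V → algebraMap F K g ∈ W) → V ≤ W)
    {w : K} (hw : w ∈ V)
    (hn : V.valuation (algebraMap F K (Algebra.norm F w)) = 1) : w⁻¹ ∈ V := by
  have hi : IsIntegral F w := Algebra.IsIntegral.isIntegral w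
  obtain ⟨e, he, -, h⟩ := norm_eq_coeff_zero_minpoly_pow (F := F) w
  have hp : V.valuation (algebraMap F K ((minpoly F w).coeff 0)) = 1 := by
    rw [h] at hn
    simp only [map_pow, map_mul, map_neg, map_one, Valuation.map_neg, one_pow, one_mul] at hn
    rcases lt_trichotomy (V.valuation (algebraMap F K ((minpoly F w).coeff 0))) 1 with h | h | h
    · exact absurd hn (pow_lt_one₀ zero_le h he.ne').ne
    · exact h
    · exact absurd hn (one_lt_pow₀ h he.ne').ne'
  -- The constant coefficient is a unit because the norm is a power of it up to sign. Splitting it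
  -- off the minimal polynomial exhibits the inverse of `w` as a unit times a polynomial in `w` over
  -- `V ∩ F`.
  have hq : w * (aeval w (minpoly F w).divX) = -algebraMap F K ((minpoly F w).coeff 0) := by
    have := congrArg (aeval w) (divX_mul_X_add (minpoly F w))
    rw [minpoly.aeval, map_add, map_mul, aeval_X, aeval_C] at this
    linear_combination this
  have hmem : aeval w (minpoly F w).divX ∈ V := by
    rw [aeval_eq_sum_range]
    refine sum_mem fun i _ => ?_
    rw [Algebra.smul_def, coeff_divX]
    exact V.mul_mem _ _ (V.minpoly_coeff_mem hV hw _) (pow_mem hw i)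
  rw [← V.valuation_le_one_iff] at hmem ⊢
  have := congrArg V.valuation hq
  rw [map_mul, Valuation.map_neg, hp] at this
  rw [map_inv₀, inv_eq_of_mul_eq_one_right this]
  exact hmem

/-- If `V` is the only valuation ring over its trace on `F`, the valuation is determined by the
norm. -/
theorem ValuationSubring.valuation_eq_one_of_norm {F K : Type*} [Field F] [Field K] [Algebra F K]
    [FiniteDimensional F K] (V : ValuationSubring K)
    (hV : ∀ W : ValuationSubring K,
      (∀ g : F, algebraMap F K g ∈ V → algebraMap F K g ∈ W) → V ≤ W)
    {w : K} (h0 : w ≠ 0)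
    (hn : V.valuation (algebraMap F K (Algebra.norm F w)) = 1) : V.valuation w = 1 := by
  rcases V.mem_or_inv_mem w with hw | hw
  · exact V.valuation_eq_one_of_mem_of_inv_mem h0 hw (V.inv_mem_of_norm hV hw hn)
  · refine V.valuation_eq_one_of_mem_of_inv_mem h0 ?_ hw
    rw [← inv_inv w]
    refine V.inv_mem_of_norm hV hw ?_
    have : Algebra.norm F w⁻¹ = (Algebra.norm F w)⁻¹ := by
      refine eq_inv_of_mul_eq_one_left ?_
      rw [← map_mul, inv_mul_cancel₀ h0, map_one]
    rw [this, map_inv₀, map_inv₀, hn, inv_one]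

end

/-! ### Valuations of the coordinates at the unique place at infinity -/

section

open Polynomial

theorem ValuationSubring.isTrivialOn_valuation {k K : Type*} [Field k] [Field K] [Algebra k K]
    {V : ValuationSubring K} (hk : ∀ c : k, algebraMap k K c ∈ V) : V.valuation.IsTrivialOn k where
  eq_one c hc := V.valuation_eq_one_of_mem_of_inv_mem (by simpa using hc) (hk c) (by
    rw [← map_inv₀]; exact hk _)

theorem ValuationSubring.one_lt_valuation_iff {K : Type*} [Field K] (V : ValuationSubring K)
    {x : K} : 1 < V.valuation x ↔ x ∉ V := by
  rw [← V.valuation_le_one_iff, not_le]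

/-- A valuation ring is integrally closed, and `K` is integral over `F`. -/
theorem ValuationSubring.eq_top_of_forall_algebraMap_mem {F K : Type*} [Field F] [Field K]
    [Algebra F K] [Algebra.IsIntegral F K] (W : ValuationSubring K)
    (h : ∀ g : F, algebraMap F K g ∈ W) : W = ⊤ := by
  refine SetLike.ext fun z => ⟨fun _ => ValuationSubring.mem_top _, fun _ => ?_⟩
  let _ : Algebra F W.toSubring := ((algebraMap F K).codRestrict W.toSubring h).toAlgebra
  have : IsScalarTower F W.toSubring K := IsScalarTower.of_algebraMap_eq fun _ => rfl
  have hz : IsIntegral W.toSubring z := (Algebra.IsIntegral.isIntegral (R := F) z).tower_top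
  exact LocalSubring.mem_of_isMax_of_isIntegral W.isMax_toLocalSubring hz

section

variable {k K : Type*} [Field k] [Field K] [Algebra k K] [Algebra k[X] K] [IsScalarTower k k[X] K]
  {y : K} {V : ValuationSubring K}

/-- If `x ∈ V`, no valuation ring over `k` could omit `x`, as it would have to be `V`. Then `x`
would be integral over `k`, but it is transcendental. -/
theorem not_mem_of_unique_place (hinj : Function.Injective (algebraMap k[X] K))
    (hV : ∀ W : ValuationSubring K, (∀ c : k, algebraMap k K c ∈ W) →
      ¬(algebraMap k[X] K X ∈ W ∧ y ∈ W) → W = V) : algebraMap k[X] K X ∉ V := by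
  intro hx
  have hint : IsIntegral k (algebraMap k[X] K X) := by
    refine isIntegral_of_forall_mem_valuationSubring _ fun W hW => ?_
    by_contra hxW
    exact hxW (hV W hW (fun h => hxW h.1) ▸ hx)
  obtain ⟨p, hp, h0⟩ := hint.isAlgebraic
  rw [aeval_algebraMap_apply, aeval_X_left_apply] at h0
  exact hp (hinj (by rw [h0, map_zero]))

/-- That `V` contains `k` is a consequence of uniqueness: otherwise every valuation ring over `k`
differs from `V`, hence contains `x`, and `x` is algebraic. -/
theorem algebraMap_mem_of_unique_place (hinj : Function.Injective (algebraMap k[X] K))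
    (hV : ∀ W : ValuationSubring K, (∀ c : k, algebraMap k K c ∈ W) →
      ¬(algebraMap k[X] K X ∈ W ∧ y ∈ W) → W = V) (c : k) : algebraMap k K c ∈ V := by
  by_contra hc
  have hint : IsIntegral k (algebraMap k[X] K X) := by
    refine isIntegral_of_forall_mem_valuationSubring _ fun W hW => ?_
    by_contra hxW
    exact hc (hV W hW (fun h => hxW h.1) ▸ hW c)
  obtain ⟨p, hp, h0⟩ := hint.isAlgebraic
  rw [aeval_algebraMap_apply, aeval_X_left_apply] at h0
  exact hp (hinj (by rw [h0, map_zero]))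

/-- If there is a unique valuation ring that does not contain both coordinates, each coordinate is
integral over the polynomials in the other one. -/
theorem isIntegral_of_unique_place (hinj : Function.Injective (algebraMap k[X] K))
    (hV : ∀ W : ValuationSubring K, (∀ c : k, algebraMap k K c ∈ W) →
      ¬(algebraMap k[X] K X ∈ W ∧ y ∈ W) → W = V) : IsIntegral k[X] y := by
  refine isIntegral_of_forall_mem_valuationSubring y fun W hW => ?_
  by_contra hy
  refine not_mem_of_unique_place hinj hV (hV W (fun c => ?_) (fun h => hy h.2) ▸ hW X)
  rw [IsScalarTower.algebraMap_apply k k[X] K]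
  exact hW _

/-- The valuations of the coordinates at the unique place at infinity. -/
theorem valuation_pow_eq_of_unique_place {F : Type*} [Field F] [Algebra k[X] F]
    [IsFractionRing k[X] F] [Algebra F K] [IsScalarTower k[X] F K]
    (hinj : Function.Injective (algebraMap k[X] K))
    (hV : ∀ W : ValuationSubring K, (∀ c : k, algebraMap k K c ∈ W) →
      ¬(algebraMap k[X] K X ∈ W ∧ y ∈ W) → W = V)
    (htop : IntermediateField.adjoin F {y} = ⊤) {P : k[X][X]} (hP : Irreducible P)
    (hy : aeval y P = 0) (h0 : P.coeff 0 ≠ 0) :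
    V.valuation y ^ P.natDegree =
      V.valuation (algebraMap k[X] K X) ^ (P.coeff 0).natDegree := by
  have hint := isIntegral_of_unique_place hinj hV
  have hxV := not_mem_of_unique_place hinj hV
  have htriv := ValuationSubring.isTrivialOn_valuation (algebraMap_mem_of_unique_place hinj hV)
  have hval (p : k[X]) (hp : p ≠ 0) : V.valuation (algebraMap k[X] K p) =
      V.valuation (algebraMap k[X] K X) ^ p.natDegree := by
    rw [← valuation_aeval_eq_valuation_X_pow_natDegree_of_one_lt_valuation_X
      (algebraMap k[X] K X) ((V.one_lt_valuation_iff).2 hxV) hp, aeval_algebraMap_apply,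
      aeval_X_left_apply]
  have hx0 : algebraMap k[X] K X ≠ 0 := by
    intro h; exact hxV (h ▸ V.zero_mem)
  have hvx0 : V.valuation (algebraMap k[X] K X) ≠ 0 := (Valuation.ne_zero_iff _).2 hx0
  have htors : Module.IsTorsionFree k[X] K := by
    have : FaithfulSMul k[X] K := (faithfulSMul_iff_algebraMap_injective _ _).2 hinj
    infer_instance
  -- By irreducibility `P` is a constant multiple of the minimal polynomial of `y` over `k[X]`, so
  -- its constant coefficient is the norm of `y` up to a nonzero constant.
  obtain ⟨q, hq⟩ := minpoly.isIntegrallyClosed_dvd hint hy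
  have hqu : IsUnit q := (of_irreducible_mul (hq ▸ hP)).resolve_left (minpoly.not_isUnit _ _)
  obtain ⟨u, hu, rfl⟩ := Polynomial.isUnit_iff.1 hqu
  obtain ⟨c, hc, rfl⟩ := Polynomial.isUnit_iff.1 hu
  have hc0 : c ≠ 0 := hc.ne_zero
  have hintF : IsIntegral F y := hint.tower_top
  have hfin : FiniteDimensional F K := by
    have := IntermediateField.adjoin.finiteDimensional hintF
    rw [htop] at this
    exact IntermediateField.topEquiv.toLinearEquiv.finiteDimensional
  have hmin : minpoly F y = (minpoly k[X] y).map (algebraMap k[X] F) :=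
    minpoly.isIntegrallyClosed_eq_field_fractions' F hint
  have hdeg : P.natDegree = (minpoly F y).natDegree := by
    rw [hq, hmin, (minpoly.monic hint).natDegree_map, natDegree_mul_C (by simpa using hc0)]
  have hrank : Module.finrank F K = (minpoly F y).natDegree := by
    rw [← IntermediateField.adjoin.finrank hintF, htop, IntermediateField.finrank_top']
  have hcoeff : (minpoly k[X] y).coeff 0 = C c⁻¹ * P.coeff 0 := by
    rw [hq, mul_coeff_zero, coeff_C_zero, mul_comm, mul_assoc, ← C_mul, mul_inv_cancel₀ hc0, C_1,
      mul_one]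
  have hcoeffne : (minpoly k[X] y).coeff 0 ≠ 0 := by
    rw [hcoeff]; exact mul_ne_zero (by simpa using hc0) h0
  have hcdeg : ((minpoly k[X] y).coeff 0).natDegree = (P.coeff 0).natDegree := by
    rw [hcoeff, natDegree_C_mul (inv_ne_zero hc0)]
  have hnormy : V.valuation (algebraMap F K (Algebra.norm F y)) =
      V.valuation (algebraMap k[X] K X) ^ (P.coeff 0).natDegree := by
    obtain ⟨e, he, h1, h2⟩ := norm_eq_coeff_zero_minpoly_pow (F := F) y
    have he1 : e = 1 := by
      rw [hrank] at h1
      exact Nat.eq_of_mul_eq_mul_left (minpoly.natDegree_pos hintF) (by rw [h1, mul_one])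
    rw [h2, he1, pow_one, hmin, coeff_map]
    simp only [map_pow, map_mul, map_neg, map_one, Valuation.map_neg, one_pow, one_mul]
    rw [← IsScalarTower.algebraMap_apply, hval _ hcoeffne, hcdeg]
  have hy0 : y ≠ 0 := by
    intro h
    rw [h, ← coeff_zero_eq_aeval_zero', map_eq_zero_iff _ hinj] at hy
    exact h0 hy
  -- `V` is the only proper valuation ring above its trace on `F`: if `x ∈ W`, then `W` contains all
  -- of `F`, since dividing a fraction by `x ^ deg p` moves it into `V`; if `x ∉ W`, uniqueness
  -- gives `W = V`.
  have hover (W : ValuationSubring K)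
      (hW : ∀ g : F, algebraMap F K g ∈ V → algebraMap F K g ∈ W) : V ≤ W := by
    by_cases hxW : algebraMap k[X] K X ∈ W
    · suffices W = ⊤ from this ▸ le_top
      refine W.eq_top_of_forall_algebraMap_mem (F := F) fun g => ?_
      obtain ⟨p, q, hq, rfl⟩ := IsFractionRing.div_surjective (A := k[X]) g
      have hq0 : q ≠ 0 := nonZeroDivisors.ne_zero hq
      by_cases hp0 : p = 0
      · simp [hp0]
      have hmem : algebraMap F K (algebraMap k[X] F p / algebraMap k[X] F q /
          algebraMap k[X] F X ^ p.natDegree) ∈ V := by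
        rw [← V.valuation_le_one_iff]
        simp only [map_div₀, map_pow, ← IsScalarTower.algebraMap_apply]
        rw [hval p hp0, hval q hq0, div_right_comm, div_self (pow_ne_zero _ hvx0), one_div]
        exact inv_le_one_of_one_le₀ (one_le_pow₀ ((V.one_lt_valuation_iff).2 hxV).le)
      have := W.mul_mem _ _ (hW _ hmem) (pow_mem hxW p.natDegree)
      rw [map_div₀, map_pow, ← IsScalarTower.algebraMap_apply k[X] F K X,
        div_mul_cancel₀ _ (pow_ne_zero _ hx0)] at this
      exact this
    · rw [hV W (fun c => ?_) fun h => hxW h.1]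
      have := hW (algebraMap k[X] F (C c))
      rw [← IsScalarTower.algebraMap_apply, ← Polynomial.algebraMap_eq,
        ← IsScalarTower.algebraMap_apply] at this
      exact this (algebraMap_mem_of_unique_place hinj hV c)
  -- The exponents are chosen so that the norm of this quotient has valuation one.
  have hw := V.valuation_eq_one_of_norm hover
    (w := y ^ P.natDegree / algebraMap k[X] K X ^ (P.coeff 0).natDegree)
    (div_ne_zero (pow_ne_zero _ hy0) (pow_ne_zero _ hx0)) (by
      have hnx : Algebra.norm F (algebraMap k[X] K X) = algebraMap k[X] F X ^ P.natDegree := by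
        rw [IsScalarTower.algebraMap_apply k[X] F K, Algebra.norm_algebraMap, hrank, hdeg]
      have : Algebra.norm F (y ^ P.natDegree / algebraMap k[X] K X ^ (P.coeff 0).natDegree) =
          Algebra.norm F y ^ P.natDegree /
            (algebraMap k[X] F X ^ P.natDegree) ^ (P.coeff 0).natDegree := by
        rw [eq_div_iff (by
          refine pow_ne_zero _ (pow_ne_zero _ ?_)
          simp), ← hnx, ← map_pow (Algebra.norm F), ← map_pow (Algebra.norm F),
          ← map_mul, div_mul_cancel₀ _ (pow_ne_zero _ hx0)]
      rw [this]
      simp only [map_div₀, map_pow, hnormy, ← IsScalarTower.algebraMap_apply]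
      rw [← pow_mul, ← pow_mul, mul_comm, div_self (pow_ne_zero _ hvx0)])
  rw [map_div₀, map_pow, map_pow] at hw
  exact (div_eq_one_iff_eq (pow_ne_zero _ hvx0)).1 hw

end

end

/-! ### Bivariate polynomials and their images in the function field -/

namespace PlaneCurve

open Polynomial

section

variable {k : Type*} [Field k]

/-- Bivariate polynomials as polynomials in `X i` over the polynomials in the other variable. -/
noncomputable def toPoly (i : Fin 2) : MvPolynomial (Fin 2) k ≃ₐ[k] k[X][X] :=
  (MvPolynomial.renameEquiv k (Equiv.swap i 0)).trans
    ((MvPolynomial.finSuccEquiv k 1).trans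
      (Polynomial.mapAlgEquiv (MvPolynomial.uniqueAlgEquiv k (Fin 1))))

theorem toPoly_X_self (i : Fin 2) : toPoly (k := k) i (MvPolynomial.X i) = X := by
  simp [toPoly, MvPolynomial.finSuccEquiv_X_zero, Polynomial.coe_mapAlgEquiv]

theorem toPoly_X_of_ne {i j : Fin 2} (h : j ≠ i) :
    toPoly (k := k) i (MvPolynomial.X j) = C X := by
  have : Equiv.swap i 0 j = Fin.succ 0 := by
    revert i j; decide
  rw [toPoly, AlgEquiv.trans_apply, AlgEquiv.trans_apply, MvPolynomial.renameEquiv_apply,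
    MvPolynomial.rename_X, this, MvPolynomial.finSuccEquiv_X_succ]
  simp [MvPolynomial.uniqueAlgEquiv]

theorem toPoly_C (i : Fin 2) (c : k) : toPoly i (MvPolynomial.C c) = C (C c) := by
  have := (toPoly (k := k) i).commutes c
  rwa [MvPolynomial.algebraMap_eq, Polynomial.algebraMap_apply, Polynomial.algebraMap_apply,
    Algebra.algebraMap_self_apply] at this

theorem natDegree_toPoly (i : Fin 2) (f : MvPolynomial (Fin 2) k) :
    (toPoly i f).natDegree = f.degreeOf i := by
  rw [toPoly, AlgEquiv.trans_apply, AlgEquiv.trans_apply, Polynomial.coe_mapAlgEquiv,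
    natDegree_map_eq_of_injective (MvPolynomial.uniqueAlgEquiv k (Fin 1)).injective,
    MvPolynomial.natDegree_finSuccEquiv, MvPolynomial.renameEquiv_apply]
  have := MvPolynomial.degreeOf_rename_of_injective (p := f) (Equiv.injective (Equiv.swap i 0)) i
  rwa [Equiv.swap_apply_left] at this

theorem coeff_toPoly {i j : Fin 2} (h : j ≠ i) (f : MvPolynomial (Fin 2) k) (a b : ℕ) :
    ((toPoly i f).coeff a).coeff b = f.coeff (Finsupp.single i a + Finsupp.single j b) := by
  induction f using MvPolynomial.induction_on' with
  | add p q hp hq => rw [map_add, coeff_add, coeff_add, hp, hq, MvPolynomial.coeff_add]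
  | monomial d c =>
    have hd : d = Finsupp.single i (d i) + Finsupp.single j (d j) := by
      ext l
      have : l = i ∨ l = j := by omega
      rcases this with rfl | rfl
      · simp [Finsupp.single_eq_of_ne h.symm]
      · simp [Finsupp.single_eq_of_ne h]
    have hiff : (a = d i ∧ b = d j) ↔ d = Finsupp.single i a + Finsupp.single j b := by
      constructor
      · rintro ⟨rfl, rfl⟩; exact hd
      · intro h'
        have h1 := DFunLike.congr_fun h' i
        have h2 := DFunLike.congr_fun h' j
        simp [Finsupp.single_eq_of_ne h.symm] at h1
        simp [Finsupp.single_eq_of_ne h] at h2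
        exact ⟨h1.symm, h2.symm⟩
    have hm : toPoly i (MvPolynomial.monomial d c) = C (C c * X ^ d j) * X ^ d i := by
      conv_lhs => rw [hd]
      rw [← one_mul c, ← MvPolynomial.monomial_mul, ← MvPolynomial.X_pow_eq_monomial, one_mul,
        ← mul_one c, ← MvPolynomial.C_mul_monomial, ← MvPolynomial.X_pow_eq_monomial]
      simp only [map_mul, map_pow, toPoly_X_self, toPoly_X_of_ne h, toPoly_C, mul_one]
      ring
    rw [hm, coeff_C_mul_X_pow, MvPolynomial.coeff_monomial]
    simp only [← hiff]
    split_ifs with h1 h2 h2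
    · rw [coeff_C_mul_X_pow, if_pos h2.2]
    · rw [coeff_C_mul_X_pow, if_neg fun h3 => h2 ⟨h1, h3⟩]
    · exact absurd h2.1 h1
    · rfl

end

section

variable {k : Type*} [Field k] (f : MvPolynomial (Fin 2) k) [hf : Fact (Irreducible f)]

/-- The image of a bivariate polynomial in the function field. -/
noncomputable def toFunctionField : MvPolynomial (Fin 2) k →ₐ[k] FunctionField f :=
  (IsScalarTower.toAlgHom k (CoordRing f) (FunctionField f)).comp
    (Ideal.Quotient.mkₐ k (Ideal.span {f}))

theorem toFunctionField_apply (g : MvPolynomial (Fin 2) k) : toFunctionField f g =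
    algebraMap (CoordRing f) (FunctionField f) (Ideal.Quotient.mk _ g) := rfl

theorem toFunctionField_eq_zero_iff (g : MvPolynomial (Fin 2) k) :
    toFunctionField f g = 0 ↔ f ∣ g := by
  rw [toFunctionField_apply, map_eq_zero_iff _ (IsFractionRing.injective _ _),
    Ideal.Quotient.eq_zero_iff_mem, Ideal.mem_span_singleton]

theorem exists_eq_div_toFunctionField (z : FunctionField f) :
    ∃ p q, toFunctionField f q ≠ 0 ∧ z = toFunctionField f p / toFunctionField f q := by
  obtain ⟨p, q, hq, rfl⟩ := IsFractionRing.div_surjective (A := CoordRing f) z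
  obtain ⟨p, rfl⟩ := Ideal.Quotient.mk_surjective p
  obtain ⟨q, rfl⟩ := Ideal.Quotient.mk_surjective q
  exact ⟨p, q, fun h => nonZeroDivisors.ne_zero hq
    (IsFractionRing.injective (CoordRing f) (FunctionField f) (h.trans (map_zero _).symm)), rfl⟩

theorem forall_algebraMap_mem_iff {V : ValuationSubring (FunctionField f)}
    (hV : ∀ c : k, algebraMap k (FunctionField f) c ∈ V) {i j : Fin 2} (hij : i ≠ j) :
    (∀ r : CoordRing f, algebraMap (CoordRing f) (FunctionField f) r ∈ V) ↔
      toFunctionField f (.X i) ∈ V ∧ toFunctionField f (.X j) ∈ V := by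
  refine ⟨fun h => ⟨h _, h _⟩, fun h r => ?_⟩
  obtain ⟨g, rfl⟩ := Ideal.Quotient.mk_surjective r
  rw [← toFunctionField_apply]
  induction g using MvPolynomial.induction_on with
  | C c => exact (toFunctionField f).commutes c ▸ hV c
  | add p q hp hq => rw [map_add]; exact V.add_mem _ _ hp hq
  | mul_X p l hp =>
    rw [map_mul]
    refine V.mul_mem _ _ hp ?_
    have : l = i ∨ l = j := by omega
    rcases this with rfl | rfl
    exacts [h.1, h.2]

variable {f}

theorem unique_place {V : ValuationSubring (FunctionField f)}
    (hV : ∀ W, IsPlaceAtInfinity f W → W = V) {i j : Fin 2} (hij : i ≠ j)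
    (W : ValuationSubring (FunctionField f)) (hW : ∀ c : k, algebraMap k (FunctionField f) c ∈ W)
    (hn : ¬(toFunctionField f (.X j) ∈ W ∧ toFunctionField f (.X i) ∈ W)) : W = V := by
  refine hV W ⟨⟨hW, ?_⟩, ?_⟩
  · rintro rfl
    exact hn ⟨ValuationSubring.mem_top _, ValuationSubring.mem_top _⟩
  · rwa [forall_algebraMap_mem_iff f hW hij.symm]

/-- A relation for `X j` alone would be a multiple of `f`, whose degree in `X i` is positive. -/
theorem aeval_toFunctionField_injective {i j : Fin 2} (hij : j ≠ i) (hi : f.degreeOf i ≠ 0) :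
    Function.Injective (aeval (R := k) (toFunctionField f (.X j))) := by
  rw [injective_iff_map_eq_zero]
  intro p hp
  rw [Polynomial.aeval_algHom_apply, toFunctionField_eq_zero_iff] at hp
  obtain ⟨q, hq⟩ := hp
  have hz : (toPoly i (aeval (MvPolynomial.X j) p)) = C p := by
    rw [← Polynomial.aeval_algHom_apply (toPoly i), toPoly_X_of_ne hij, ← Polynomial.CAlgHom_apply (R := k),
      Polynomial.aeval_algHom_apply, aeval_X_left_apply]
    rfl
  by_contra hp0
  have hq0 : f * q ≠ 0 := by
    rw [← hq]
    intro h
    rw [h, map_zero] at hz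
    exact hp0 (by simpa using hz.symm)
  have := natDegree_toPoly i (f * q)
  rw [← hq, hz, natDegree_C, hq, MvPolynomial.degreeOf_mul_eq (left_ne_zero_of_mul hq0)
    (right_ne_zero_of_mul hq0)] at this
  omega

end

end PlaneCurve

/-! ### The Newton polygon -/

namespace PlaneCurve

open Polynomial

variable {k : Type*} [Field k] {f : MvPolynomial (Fin 2) k} [hf : Fact (Irreducible f)]

theorem eval₂_toPoly {i j : Fin 2} (hij : j ≠ i) (g : MvPolynomial (Fin 2) k) :
    eval₂ (aeval (R := k) (toFunctionField f (.X j))).toRingHom (toFunctionField f (.X i))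
      (toPoly i g) = toFunctionField f g := by
  induction g using MvPolynomial.induction_on with
  | C c =>
    rw [toPoly_C, eval₂_C]
    simp only [AlgHom.toRingHom_eq_coe, RingHom.coe_coe, aeval_C]
    exact ((toFunctionField f).commutes c).symm
  | add p q hp hq => rw [map_add, map_add, eval₂_add, hp, hq]
  | mul_X p l hp =>
    rw [map_mul, map_mul, eval₂_mul, hp]
    congr 1
    have : l = i ∨ l = j := by omega
    rcases this with rfl | rfl
    · rw [toPoly_X_self, eval₂_X]
    · rw [toPoly_X_of_ne hij, eval₂_C]
      simp

theorem isUnit_leadingCoeff_and_valuation_pow_eq {V : ValuationSubring (FunctionField f)}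
    (hV : ∀ W, IsPlaceAtInfinity f W → W = V) {i j : Fin 2} (hij : j ≠ i)
    (hi : f.degreeOf i ≠ 0) :
    IsUnit (toPoly i f).leadingCoeff ∧ ((toPoly i f).coeff 0 ≠ 0 →
      V.valuation (toFunctionField f (.X i)) ^ (toPoly i f).natDegree =
        V.valuation (toFunctionField f (.X j)) ^ ((toPoly i f).coeff 0).natDegree) := by
  let _ : Algebra k[X] (FunctionField f) :=
    (aeval (R := k) (toFunctionField f (.X j))).toRingHom.toAlgebra
  have : IsScalarTower k k[X] (FunctionField f) := IsScalarTower.of_algebraMap_eq fun c =>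
    ((aeval (R := k) (toFunctionField f (.X j))).commutes c).symm
  have hinj : Function.Injective (algebraMap k[X] (FunctionField f)) :=
    aeval_toFunctionField_injective hij hi
  have hX : algebraMap k[X] (FunctionField f) X = toFunctionField f (.X j) := aeval_X _
  have huniq (W : ValuationSubring (FunctionField f))
      (hW : ∀ c : k, algebraMap k (FunctionField f) c ∈ W)
      (hn : ¬(algebraMap k[X] (FunctionField f) X ∈ W ∧ toFunctionField f (.X i) ∈ W)) : W = V :=
    unique_place hV hij.symm W hW (by rwa [hX] at hn)
  have hirr : Irreducible (toPoly i f) := (MulEquiv.irreducible_iff (toPoly i)).2 hf.out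
  have hroot (g : MvPolynomial (Fin 2) k) :
      aeval (toFunctionField f (.X i)) (toPoly i g) = toFunctionField f g := eval₂_toPoly hij g
  have hroot0 : aeval (toFunctionField f (.X i)) (toPoly i f) = 0 := by
    rw [hroot, toFunctionField_eq_zero_iff]
  have : FaithfulSMul k[X] (FunctionField f) := (faithfulSMul_iff_algebraMap_injective _ _).2 hinj
  refine ⟨(minpoly.IsIntegrallyClosed.isIntegral_iff_isUnit_leadingCoeff hirr hroot0).1
    (isIntegral_of_unique_place hinj huniq), fun h0 => ?_⟩
  let _ : Algebra (FractionRing k[X]) (FunctionField f) := FractionRing.liftAlgebra _ _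
  rw [← hX]
  refine valuation_pow_eq_of_unique_place (F := FractionRing k[X]) hinj huniq ?_ hirr hroot0 h0
  refine eq_top_iff.2 fun z _ => ?_
  have hmem (g : MvPolynomial (Fin 2) k) : toFunctionField f g ∈
      IntermediateField.adjoin (FractionRing k[X]) {toFunctionField f (.X i)} := by
    rw [← hroot g, aeval_eq_sum_range]
    refine sum_mem fun l _ => ?_
    rw [Algebra.smul_def, IsScalarTower.algebraMap_apply k[X] (FractionRing k[X])]
    exact mul_mem (IntermediateField.algebraMap_mem _ _)
      (pow_mem (IntermediateField.mem_adjoin_simple_self _ _) l)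
  obtain ⟨p, q, -, rfl⟩ := exists_eq_div_toFunctionField f z
  exact div_mem (hmem p) (hmem q)

/-- The Newton polygon of a curve of bidegree `(3, 4)` with one place at infinity. -/
theorem newton_polygon (h : HasOnePlaceAtInfinity f) (h1 : f.degreeOf 1 = 4)
    (h0 : f.degreeOf 0 = 3) :
    f.coeff (Finsupp.single 0 3) ≠ 0 ∧ f.coeff (Finsupp.single 1 4) ≠ 0 ∧
      ∀ d ∈ f.support, 4 * d 0 + 3 * d 1 ≤ 12 := by
  obtain ⟨V, hVinf, hV⟩ := h
  have hX := isUnit_leadingCoeff_and_valuation_pow_eq hV (i := 0) (j := 1) (by decide) (by omega)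
  have hY := isUnit_leadingCoeff_and_valuation_pow_eq hV (i := 1) (j := 0) (by decide) (by omega)
  have hcoeff {i j : Fin 2} (hij : j ≠ i) (hu : IsUnit (toPoly i f).leadingCoeff) :
      f.coeff (Finsupp.single i (f.degreeOf i)) ≠ 0 := by
    obtain ⟨c, hc, hc'⟩ := Polynomial.isUnit_iff.1 hu
    have := coeff_toPoly hij f (f.degreeOf i) 0
    rw [← natDegree_toPoly, coeff_natDegree, ← hc', coeff_C_zero, Finsupp.single_zero,
      add_zero] at this
    rw [← natDegree_toPoly, ← this]
    exact hc.ne_zero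
  have hX3 := hcoeff (j := 1) (by decide) hX.1
  have hY4 := hcoeff (j := 0) (by decide) hY.1
  rw [h0] at hX3
  rw [h1] at hY4
  refine ⟨hX3, hY4, ?_⟩
  have hd0 (d) (hd : d ∈ f.support) : d 0 ≤ 3 := h0 ▸ MvPolynomial.monomial_le_degreeOf 0 hd
  have hd1 (d) (hd : d ∈ f.support) : d 1 ≤ 4 := h1 ▸ MvPolynomial.monomial_le_degreeOf 1 hd
  have hc3 : ((toPoly 1 f).coeff 0).coeff 3 ≠ 0 := by
    rw [coeff_toPoly (j := 0) (by decide), Finsupp.single_zero, zero_add]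
    exact hX3
  have hdeg : ((toPoly 1 f).coeff 0).natDegree = 3 := by
    refine le_antisymm (natDegree_le_iff_coeff_eq_zero.2 fun n hn => ?_)
      (le_natDegree_of_ne_zero hc3)
    rw [coeff_toPoly (j := 0) (by decide), Finsupp.single_zero, zero_add]
    by_contra hne
    have := hd0 _ (MvPolynomial.mem_support_iff.2 hne)
    rw [Finsupp.single_eq_same] at this
    omega
  have hval := hY.2 fun h => hc3 (by rw [h, coeff_zero])
  rw [natDegree_toPoly, h1, hdeg] at hval
  set A := V.valuation (toFunctionField f (.X 0)) with hA
  set B := V.valuation (toFunctionField f (.X 1)) with hB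
  -- If `x` were in `V`, the relation `B ^ 4 = A ^ 3` would put `y` in `V` too, and `V` would be at
  -- finite distance.
  have hA1 : 1 < A := by
    by_contra hle
    refine hVinf.2 ((forall_algebraMap_mem_iff f hVinf.1.1 (i := 0) (j := 1) (by decide)).2 ?_)
    have hA' := not_lt.1 hle
    refine ⟨(V.valuation_le_one_iff _).1 hA', (V.valuation_le_one_iff _).1 ?_⟩
    by_contra hB'
    exact absurd hval (((pow_le_one₀ zero_le hA').trans_lt
      (one_lt_pow₀ (not_le.1 hB') (by norm_num))).ne')
  have htriv := ValuationSubring.isTrivialOn_valuation hVinf.1.1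
  have hterm (d : Fin 2 →₀ ℕ) (hd : d ∈ f.support) :
      V.valuation (toFunctionField f (MvPolynomial.monomial d (f.coeff d))) =
        A ^ d 0 * B ^ d 1 := by
    have : MvPolynomial.monomial d (f.coeff d) =
        MvPolynomial.C (f.coeff d) * (MvPolynomial.X 0 ^ d 0 * MvPolynomial.X 1 ^ d 1) := by
      rw [MvPolynomial.monomial_eq, Finsupp.prod_fintype _ _ (by simp), Fin.prod_univ_two]
    rw [this, map_mul, map_mul, map_mul, map_pow, map_pow, map_mul, map_pow, map_pow,
      ← MvPolynomial.algebraMap_eq, AlgHom.commutes,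
      htriv.eq_one _ (MvPolynomial.mem_support_iff.1 hd), one_mul]
  have hlt (d d' : Fin 2 →₀ ℕ) (h : 4 * d 0 + 3 * d 1 < 4 * d' 0 + 3 * d' 1) :
      A ^ d 0 * B ^ d 1 < A ^ d' 0 * B ^ d' 1 := by
    have h4 (e : Fin 2 →₀ ℕ) : (A ^ e 0 * B ^ e 1) ^ 4 = A ^ (4 * e 0 + 3 * e 1) := by
      rw [mul_pow, ← pow_mul, ← pow_mul, mul_comm (e 1), pow_mul B, hval, ← pow_mul, ← pow_add,
        mul_comm (e 0)]
    refine lt_of_pow_lt_pow_left₀ 4 zero_le ?_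
    rw [h4, h4]
    exact pow_lt_pow_right₀ hA1 h
  obtain ⟨d, hd, hmax⟩ := f.support.exists_max_image (fun d => 4 * d 0 + 3 * d 1)
    ⟨_, MvPolynomial.mem_support_iff.2 hX3⟩
  by_contra! hcon
  obtain ⟨d', hd', h12⟩ := hcon
  have hd12 : 12 < 4 * d 0 + 3 * d 1 := h12.trans_le (hmax d' hd')
  -- In the box `i ≤ 3`, `j ≤ 4` the only two monomials of equal weight `4 i + 3 j` are `X^3` and
  -- `Y^4`, of weight 12. Above 12 the monomial of maximal weight is therefore unique and dominates
  -- the sum.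
  have hstrict (e) (he : e ∈ f.support) (hne : e ≠ d) :
      4 * e 0 + 3 * e 1 < 4 * d 0 + 3 * d 1 := by
    refine lt_of_le_of_ne (hmax e he) fun heq => hne ?_
    have := hd0 e he; have := hd1 e he; have := hd0 d hd; have := hd1 d hd
    ext l
    fin_cases l
    · change e 0 = d 0; omega
    · change e 1 = d 1; omega
  have hsum : V.valuation (toFunctionField f f) = A ^ d 0 * B ^ d 1 := by
    have hs : toFunctionField f f =
        ∑ e ∈ f.support, toFunctionField f (MvPolynomial.monomial e (f.coeff e)) := by
      rw [← map_sum, MvPolynomial.support_sum_monomial_coeff]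
    rw [hs, ← hterm d hd]
    refine Valuation.map_sum_eq_of_lt _ hd (fun e he => ?_)
    rw [Finset.mem_sdiff, Finset.mem_singleton] at he
    rw [hterm d hd, hterm e he.1]
    exact hlt _ _ (hstrict e he.1 he.2)
  rw [(toFunctionField_eq_zero_iff f f).2 dvd_rfl, map_zero] at hsum
  have hpos : 0 < A := zero_lt_one.trans hA1
  have hB0 : B ≠ 0 := by
    intro h; rw [h, zero_pow (by norm_num)] at hval
    exact pow_ne_zero 3 hpos.ne' hval.symm
  exact mul_ne_zero (pow_ne_zero _ hpos.ne') (pow_ne_zero _ hB0) hsum.symm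

end PlaneCurve

/-! ### The length condition and invariance of the Jacobian ideal -/

namespace PlaneCurve

open MvPolynomial

variable {k : Type*} [Field k]

/-- Along the Milnor algebra, multiplication by `f` has rank one. -/
def IsRankOne (f : MvPolynomial (Fin 2) k) : Prop :=
  f ∉ jacobianIdeal f ∧ ∃ p : Fin 2 → k, ∀ g, (g - C (eval p g)) * f ∈ jacobianIdeal f

/-- The kernel of `A/J → A/(f, J)` has length one, hence is simple and spanned by the class of `f`.
The annihilator of that class is a maximal ideal, which is a point by the Nullstellensatz. -/
theorem isRankOne_of_length [IsAlgClosed k] {f : MvPolynomial (Fin 2) k}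
    [Module.Finite k (MvPolynomial (Fin 2) k ⧸ jacobianIdeal f)]
    (h : milnorPencil f = tjurina f + 1) : IsRankOne f := by
  have : IsArtinian (MvPolynomial (Fin 2) k) (MvPolynomial (Fin 2) k ⧸ jacobianIdeal f) := isArtinian_of_tower k inferInstance
  have : IsNoetherian (MvPolynomial (Fin 2) k) (MvPolynomial (Fin 2) k ⧸ jacobianIdeal f) := isNoetherian_of_tower k inferInstance
  have hle : jacobianIdeal f ≤ Ideal.span {f} ⊔ jacobianIdeal f := le_sup_right
  let g : (MvPolynomial (Fin 2) k ⧸ jacobianIdeal f) →ₗ[MvPolynomial (Fin 2) k] (MvPolynomial (Fin 2) k ⧸ (Ideal.span {f} ⊔ jacobianIdeal f)) :=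
    Submodule.factor hle
  have hg : Function.Surjective g := Submodule.factor_surjective hle
  have hadd := Module.length_eq_add_of_exact (LinearMap.ker g).subtype g
    (Submodule.subtype_injective _) hg (LinearMap.exact_subtype_ker_map g)
  have htop : Module.length (MvPolynomial (Fin 2) k) (MvPolynomial (Fin 2) k ⧸ jacobianIdeal f) ≠ ⊤ := Module.length_ne_top
  -- Lengths live in `ℕ∞`; finiteness is what allows cancelling `tjurina f`.
  have hnu : tjurina f ≠ ⊤ := by
    intro hn
    rw [hn, top_add] at h
    exact htop h
  have hone : Module.length (MvPolynomial (Fin 2) k) (LinearMap.ker g) = 1 := by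
    have h' : tjurina f + Module.length (MvPolynomial (Fin 2) k) (LinearMap.ker g) = tjurina f + 1 := by
      rw [← h, add_comm]; exact hadd.symm
    exact (ENat.addLECancellable_of_ne_top hnu).inj.1 h'
  have hsimple : IsSimpleModule (MvPolynomial (Fin 2) k) (LinearMap.ker g) := Module.length_eq_one_iff.1 hone
  have hmk (a : MvPolynomial (Fin 2) k) : (Submodule.Quotient.mk a : MvPolynomial (Fin 2) k ⧸ jacobianIdeal f) ∈ LinearMap.ker g ↔
      a ∈ Ideal.span {f} ⊔ jacobianIdeal f := by
    rw [LinearMap.mem_ker]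
    exact Submodule.Quotient.mk_eq_zero _
  have hfker : (Submodule.Quotient.mk f : MvPolynomial (Fin 2) k ⧸ jacobianIdeal f) ∈ LinearMap.ker g :=
    (hmk f).2 (Ideal.mem_sup_left (Ideal.mem_span_singleton_self f))
  have hfJ : f ∉ jacobianIdeal f := by
    intro hf
    have hbot : Ideal.span {f} ⊔ jacobianIdeal f = jacobianIdeal f :=
      sup_eq_right.2 ((Ideal.span_singleton_le_iff_mem _).2 hf)
    have := hsimple.nontrivial
    obtain ⟨⟨x, hx⟩, hx0⟩ := exists_ne (0 : LinearMap.ker g)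
    obtain ⟨a, rfl⟩ := Submodule.Quotient.mk_surjective _ x
    refine hx0 (Subtype.ext ?_)
    rw [hmk, hbot] at hx
    exact (Submodule.Quotient.mk_eq_zero _).2 hx
  refine ⟨hfJ, ?_⟩
  let s : LinearMap.ker g := ⟨Submodule.Quotient.mk f, hfker⟩
  have hs : s ≠ 0 := fun h0 => hfJ ((Submodule.Quotient.mk_eq_zero _).1 (congrArg Subtype.val h0))
  obtain ⟨p, hp⟩ := isMaximal_iff_eq_vanishingIdeal_singleton.1
    (IsSimpleModule.ker_toSpanSingleton_isMaximal (MvPolynomial (Fin 2) k) hs)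
  refine ⟨p, fun a => ?_⟩
  have hmem : a - C (eval p a) ∈ LinearMap.ker (LinearMap.toSpanSingleton (MvPolynomial (Fin 2) k) (LinearMap.ker g) s) := by
    rw [hp, mem_vanishingIdeal_singleton_iff]
    simp
  have := congrArg Subtype.val (LinearMap.mem_ker.1 hmem)
  exact (Submodule.Quotient.mk_eq_zero _).1 this

theorem pderiv_algEquiv (σ : MvPolynomial (Fin 2) k ≃ₐ[k] MvPolynomial (Fin 2) k) (i : Fin 2)
    (f : MvPolynomial (Fin 2) k) :
    pderiv i (σ f) = σ (pderiv 0 f) * pderiv i (σ (X 0)) + σ (pderiv 1 f) * pderiv i (σ (X 1)) := by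
  induction f using MvPolynomial.induction_on with
  | C c => rw [← algebraMap_eq, AlgEquiv.commutes, algebraMap_eq]; simp
  | add p q hp hq => simp only [map_add, hp, hq]; ring
  | mul_X p l hp =>
    simp only [map_mul, Derivation.leibniz, hp, smul_eq_mul, map_add]
    fin_cases l <;> simp <;> ring

theorem jacobianIdeal_algEquiv_le (σ : MvPolynomial (Fin 2) k ≃ₐ[k] MvPolynomial (Fin 2) k)
    (f : MvPolynomial (Fin 2) k) : jacobianIdeal (σ f) ≤ (jacobianIdeal f).map σ := by
  have h0 : σ (pderiv 0 f) ∈ (jacobianIdeal f).map σ :=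
    Ideal.mem_map_of_mem _ (Ideal.subset_span (by simp))
  have h1 : σ (pderiv 1 f) ∈ (jacobianIdeal f).map σ :=
    Ideal.mem_map_of_mem _ (Ideal.subset_span (by simp))
  rw [jacobianIdeal, Ideal.span_le]
  rintro _ (rfl | rfl) <;> rw [pderiv_algEquiv] <;>
    exact Ideal.add_mem _ (Ideal.mul_mem_right _ _ h0) (Ideal.mul_mem_right _ _ h1)

theorem jacobianIdeal_algEquiv (σ : MvPolynomial (Fin 2) k ≃ₐ[k] MvPolynomial (Fin 2) k)
    (f : MvPolynomial (Fin 2) k) : jacobianIdeal (σ f) = (jacobianIdeal f).map σ := by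
  refine le_antisymm (jacobianIdeal_algEquiv_le σ f) ?_
  have := Ideal.map_mono (f := σ) (jacobianIdeal_algEquiv_le σ.symm (σ f))
  rw [AlgEquiv.symm_apply_apply] at this
  refine this.trans (Ideal.map_le_iff_le_comap.2 (Ideal.map_le_iff_le_comap.2 fun x hx => ?_))
  simpa using hx

theorem mem_jacobianIdeal_algEquiv {σ : MvPolynomial (Fin 2) k ≃ₐ[k] MvPolynomial (Fin 2) k}
    {f g : MvPolynomial (Fin 2) k} : σ g ∈ jacobianIdeal (σ f) ↔ g ∈ jacobianIdeal f := by
  constructor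
  · intro h
    have := Ideal.mem_map_of_mem σ.symm h
    rwa [← jacobianIdeal_algEquiv, AlgEquiv.symm_apply_apply, AlgEquiv.symm_apply_apply] at this
  · intro h
    rw [jacobianIdeal_algEquiv]
    exact Ideal.mem_map_of_mem σ h

theorem jacobianIdeal_C_mul {c : k} (hc : c ≠ 0) (f : MvPolynomial (Fin 2) k) :
    jacobianIdeal (C c * f) = jacobianIdeal f := by
  have hu : IsUnit (C c : MvPolynomial (Fin 2) k) := (IsUnit.mk0 c hc).map C
  rw [jacobianIdeal, jacobianIdeal]
  simp only [pderiv_C_mul]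
  refine le_antisymm (Ideal.span_le.2 ?_) (Ideal.span_le.2 ?_)
  · rintro _ (rfl | rfl) <;> exact Ideal.mul_mem_left _ _ (Ideal.subset_span (by simp))
  · rintro _ (rfl | rfl)
    · exact (Ideal.unit_mul_mem_iff_mem _ hu).1 (Ideal.subset_span (by simp))
    · exact (Ideal.unit_mul_mem_iff_mem _ hu).1 (Ideal.subset_span (by simp))

theorem IsRankOne.algEquiv {f : MvPolynomial (Fin 2) k} (h : IsRankOne f)
    (σ : MvPolynomial (Fin 2) k ≃ₐ[k] MvPolynomial (Fin 2) k) : IsRankOne (σ f) := by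
  obtain ⟨h1, p, hp⟩ := h
  refine ⟨fun h => h1 (mem_jacobianIdeal_algEquiv.1 h), fun i => eval p (σ.symm (X i)), fun g => ?_⟩
  have hev : eval (fun i => eval p (σ.symm (X i))) g = eval p (σ.symm g) := by
    have : (aeval (R := k) fun i => eval p (σ.symm (X i))) =
        (aeval (R := k) p).comp σ.symm.toAlgHom := by
      ext i; simp [aeval_eq_eval]
    simpa [aeval_eq_eval] using DFunLike.congr_fun this g
  have := mem_jacobianIdeal_algEquiv (σ := σ).2 (hp (σ.symm g))
  rw [map_mul, map_sub, AlgEquiv.apply_symm_apply, ← hev, ← algebraMap_eq, AlgEquiv.commutes] at this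
  exact this

theorem IsRankOne.C_mul {f : MvPolynomial (Fin 2) k} (h : IsRankOne f) {c : k} (hc : c ≠ 0) :
    IsRankOne (C c * f) := by
  have hu : IsUnit (C c : MvPolynomial (Fin 2) k) := (IsUnit.mk0 c hc).map C
  obtain ⟨h1, p, hp⟩ := h
  rw [IsRankOne, jacobianIdeal_C_mul hc, Ideal.unit_mul_mem_iff_mem _ hu]
  refine ⟨h1, p, fun g => ?_⟩
  rw [mul_left_comm]
  exact Ideal.mul_mem_left _ _ (hp g)

end PlaneCurve

/-! ### Reduction to the unfolding of `X^3 + Y^4` -/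

namespace PlaneCurve

open MvPolynomial

variable {k : Type*} [Field k]

/-- The normal form of a curve of bidegree `(3, 4)` with one place at infinity: the unfolding of
`X³ + Y⁴`. -/
noncomputable def unfolding (a b c d e g : k) : MvPolynomial (Fin 2) k :=
  X 0 ^ 3 + X 0 * (C a * X 1 ^ 2 + C b * X 1 + C c) + X 1 ^ 4 + C d * X 1 ^ 2 + C e * X 1 + C g

/-- The triangular affine change of coordinates. -/
noncomputable def affineEquiv (l m p q r : k) (hl : l ≠ 0) (hm : m ≠ 0) :
    MvPolynomial (Fin 2) k ≃ₐ[k] MvPolynomial (Fin 2) k :=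
  AlgEquiv.ofAlgHom (aeval ![C l * X 0 + C p * X 1 + C q, C m * X 1 + C r])
    (aeval ![C l⁻¹ * (X 0 - C p * (C m⁻¹ * (X 1 - C r)) - C q), C m⁻¹ * (X 1 - C r)])
    (by
      have h1 : (C l : MvPolynomial (Fin 2) k) * C l⁻¹ = 1 := by
        rw [← C_mul, mul_inv_cancel₀ hl, C_1]
      have h2 : (C m : MvPolynomial (Fin 2) k) * C m⁻¹ = 1 := by
        rw [← C_mul, mul_inv_cancel₀ hm, C_1]
      refine algHom_ext fun i => ?_
      fin_cases i
      · simp [algHom_C]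
        linear_combination X 0 * h1 - C l⁻¹ * C p * X 1 * h2
      · simp [algHom_C]
        linear_combination X 1 * h2)
    (by
      have h1 : (C l : MvPolynomial (Fin 2) k) * C l⁻¹ = 1 := by
        rw [← C_mul, mul_inv_cancel₀ hl, C_1]
      have h2 : (C m : MvPolynomial (Fin 2) k) * C m⁻¹ = 1 := by
        rw [← C_mul, mul_inv_cancel₀ hm, C_1]
      refine algHom_ext fun i => ?_
      fin_cases i
      · simp [algHom_C]
        linear_combination (X 0 - C p * (C m⁻¹ * (X 1 - C r)) - C q) * h1
      · simp [algHom_C]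
        linear_combination (X 1 - C r) * h2)

theorem affineEquiv_X_zero {l m p q r : k} (hl : l ≠ 0) (hm : m ≠ 0) :
    affineEquiv l m p q r hl hm (X 0) = C l * X 0 + C p * X 1 + C q := by
  simp [affineEquiv]

theorem affineEquiv_X_one {l m p q r : k} (hl : l ≠ 0) (hm : m ≠ 0) :
    affineEquiv l m p q r hl hm (X 1) = C m * X 1 + C r := by
  simp [affineEquiv]

theorem affineEquiv_C {l m p q r : k} (hl : l ≠ 0) (hm : m ≠ 0) (c : k) :
    affineEquiv l m p q r hl hm (C c) = C c := by
  rw [← algebraMap_eq, AlgEquiv.commutes]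

theorem eq_of_newton_polygon {f : MvPolynomial (Fin 2) k}
    (h : ∀ d ∈ f.support, 4 * d 0 + 3 * d 1 ≤ 12) :
    ∃ n : ℕ → ℕ → k, n 3 0 = f.coeff (Finsupp.single 0 3) ∧ n 0 4 = f.coeff (Finsupp.single 1 4) ∧
    f = C (n 3 0) * X 0 ^ 3 + C (n 0 4) * X 1 ^ 4 + C (n 2 1) * X 0 ^ 2 * X 1 +
      C (n 2 0) * X 0 ^ 2 + C (n 1 2) * X 0 * X 1 ^ 2 + C (n 1 1) * X 0 * X 1 + C (n 1 0) * X 0 +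
      C (n 0 3) * X 1 ^ 3 + C (n 0 2) * X 1 ^ 2 + C (n 0 1) * X 1 + C (n 0 0) := by
  classical
  let φ : ℕ × ℕ → (Fin 2 →₀ ℕ) := fun x => Finsupp.single 0 x.1 + Finsupp.single 1 x.2
  have hφ : Function.Injective φ := by
    intro x y hxy
    have h0 := DFunLike.congr_fun hxy 0
    have h1 := DFunLike.congr_fun hxy 1
    simp [φ] at h0 h1
    exact Prod.ext h0 h1
  let S : Finset (ℕ × ℕ) := {(3, 0), (0, 4), (2, 1), (2, 0), (1, 2), (1, 1), (1, 0), (0, 3), (0, 2),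
    (0, 1), (0, 0)}
  have hS : f.support ⊆ S.image φ := by
    intro d hd
    refine Finset.mem_image.2 ⟨(d 0, d 1), ?_, ?_⟩
    · have := h d hd
      simp only [S, Finset.mem_insert, Finset.mem_singleton, Prod.mk.injEq]
      omega
    · ext i
      fin_cases i <;> simp [φ]
  refine ⟨fun i j => f.coeff (φ (i, j)), by simp [φ], by simp [φ], ?_⟩
  have hterm (x : ℕ × ℕ) : monomial (φ x) (f.coeff (φ x)) =
      C (f.coeff (φ x)) * X 0 ^ x.1 * X 1 ^ x.2 := by
    rw [monomial_eq, Finsupp.prod_fintype _ _ (by simp), Fin.prod_univ_two]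
    simp [φ, mul_assoc]
  have hsum : f = ∑ x ∈ S, monomial (φ x) (f.coeff (φ x)) := by
    rw [← Finset.sum_image (f := fun d => monomial d (f.coeff d)) (hφ.injOn),
      ← Finset.sum_subset hS fun d _ hd => by rw [notMem_support_iff.1 hd, map_zero],
      support_sum_monomial_coeff]
  conv_lhs => rw [hsum]
  simp only [hterm]
  simp [S, Finset.sum_insert]
  ring

/-- This is completing the cube and the quartic: `p` removes `X^2 Y`, then `r` removes `Y^3`, then
`q` removes `X^2`. The scalars `u` and `l` make the coefficients of `Y^4` and `X^3` equal to one. -/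
theorem exists_affineEquiv_eq_unfolding [IsAlgClosed k] [CharZero k] {f : MvPolynomial (Fin 2) k}
    (h : ∀ d ∈ f.support, 4 * d 0 + 3 * d 1 ≤ 12) (h3 : f.coeff (Finsupp.single 0 3) ≠ 0)
    (h4 : f.coeff (Finsupp.single 1 4) ≠ 0) :
    ∃ (σ : MvPolynomial (Fin 2) k ≃ₐ[k] MvPolynomial (Fin 2) k) (u : k) (a b c d e g : k),
      u ≠ 0 ∧ C u * σ f = unfolding a b c d e g := by
  obtain ⟨n, hn3, hn4, hf⟩ := eq_of_newton_polygon h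
  rw [← hn3] at h3
  rw [← hn4] at h4
  set u := (n 0 4)⁻¹ with hu
  obtain ⟨l, hl⟩ := IsAlgClosed.exists_pow_nat_eq (n 0 4 / n 3 0) (n := 3) (by norm_num)
  have hl0 : l ≠ 0 := by
    rintro rfl
    rw [zero_pow (by norm_num)] at hl
    exact div_ne_zero h4 h3 hl.symm
  obtain ⟨p, hp⟩ : ∃ p, 3 * n 3 0 * p + n 2 1 = 0 := ⟨-n 2 1 / (3 * n 3 0), by field_simp; ring⟩
  obtain ⟨r, hr⟩ : ∃ r, n 3 0 * p ^ 3 + n 2 1 * p ^ 2 + n 1 2 * p + n 0 3 + 4 * n 0 4 * r = 0 :=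
    ⟨-(n 3 0 * p ^ 3 + n 2 1 * p ^ 2 + n 1 2 * p + n 0 3) / (4 * n 0 4), by field_simp; ring⟩
  obtain ⟨q, hq⟩ : ∃ q, 3 * n 3 0 * q + n 2 1 * r + n 2 0 = 0 :=
    ⟨-(n 2 1 * r + n 2 0) / (3 * n 3 0), by field_simp; ring⟩
  refine ⟨affineEquiv l 1 p q r hl0 one_ne_zero, u,
    u * (l * (3 * n 3 0 * p ^ 2 + 2 * n 2 1 * p + n 1 2)),
    u * (l * (6 * n 3 0 * p * q + 2 * n 2 1 * (q + p * r) + 2 * n 2 0 * p + 2 * n 1 2 * r + n 1 1)),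
    u * (l * (3 * n 3 0 * q ^ 2 + 2 * n 2 1 * q * r + 2 * n 2 0 * q + n 1 2 * r ^ 2 + n 1 1 * r +
      n 1 0)),
    u * (3 * n 3 0 * p ^ 2 * q + 6 * n 0 4 * r ^ 2 + n 2 1 * (2 * p * q + p ^ 2 * r) +
      n 2 0 * p ^ 2 + n 1 2 * (q + 2 * p * r) + n 1 1 * p + 3 * n 0 3 * r + n 0 2),
    u * (3 * n 3 0 * p * q ^ 2 + 4 * n 0 4 * r ^ 3 + n 2 1 * (q ^ 2 + 2 * p * q * r) +
      2 * n 2 0 * p * q + n 1 2 * (p * r ^ 2 + 2 * q * r) + n 1 1 * (q + p * r) + n 1 0 * p +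
      3 * n 0 3 * r ^ 2 + 2 * n 0 2 * r + n 0 1),
    u * (n 3 0 * q ^ 3 + n 0 4 * r ^ 4 + n 2 1 * q ^ 2 * r + n 2 0 * q ^ 2 + n 1 2 * q * r ^ 2 +
      n 1 1 * q * r + n 1 0 * q + n 0 3 * r ^ 3 + n 0 2 * r ^ 2 + n 0 1 * r + n 0 0),
    inv_ne_zero h4, ?_⟩
  have hu4 : u * n 0 4 = 1 := inv_mul_cancel₀ h4
  have hu3 : u * (l ^ 3 * n 3 0) = 1 := by
    rw [hl, div_mul_cancel₀ _ h3, hu4]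
  replace hu4 := congrArg (C (σ := Fin 2)) hu4
  replace hu3 := congrArg (C (σ := Fin 2)) hu3
  replace hp := congrArg (C (σ := Fin 2)) hp
  replace hq := congrArg (C (σ := Fin 2)) hq
  replace hr := congrArg (C (σ := Fin 2)) hr
  rw [hf, unfolding]
  simp only [map_add, map_mul, map_pow, affineEquiv_C, affineEquiv_X_zero, affineEquiv_X_one, C_1,
    C_0, one_mul, map_ofNat] at hu4 hu3 hp hq hr ⊢
  linear_combination X 0 ^ 3 * hu3 + X 1 ^ 4 * hu4 +
    C u * C l ^ 2 * (X 0 ^ 2 * X 1 * hp + X 0 ^ 2 * hq) + C u * X 1 ^ 3 * hr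

theorem pderiv_zero_unfolding (a b c d e g : k) : pderiv 0 (unfolding a b c d e g) =
    3 * X 0 ^ 2 + (C a * X 1 ^ 2 + C b * X 1 + C c) := by
  simp [unfolding]

theorem pderiv_one_unfolding (a b c d e g : k) : pderiv 1 (unfolding a b c d e g) =
    X 0 * (2 * C a * X 1 + C b) + (4 * X 1 ^ 3 + 2 * C d * X 1 + C e) := by
  simp [unfolding]
  ring

end PlaneCurve

/-! ### Monomial basis and finiteness of the Milnor algebra -/

namespace PlaneCurve

open Polynomial

section

variable {k : Type*} [Field k]

/-- No nonzero pair of polynomials of degree at most two is of the form `(pB - qCD, pC + qB)`. -/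
theorem eq_zero_of_natDegree_le_two {B D E p q h₀ h₁ : k[X]} (hB : B.natDegree = 3)
    (hE : E.natDegree ≤ 1) (hD : D.natDegree ≤ 2) (hh₀ : h₀.natDegree ≤ 2) (hh₁ : h₁.natDegree ≤ 2)
    (h0 : h₀ = p * B - q * E * D) (h1 : h₁ = p * E + q * B) : h₀ = 0 ∧ h₁ = 0 := by
  have hB0 : B ≠ 0 := by rintro rfl; simp at hB
  by_cases hq : q = 0
  · subst hq
    by_cases hp : p = 0
    · subst hp; simp [h0, h1]
    · rw [zero_mul, zero_mul, sub_zero] at h0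
      have := natDegree_mul hp hB0
      rw [← h0] at this
      omega
  -- The second equation forces `deg p ≥ deg q + 2`, the first `deg p ≤ deg q`.
  · exfalso
    have e1 : q * B = h₁ - p * E := by rw [h1]; ring
    have e0 : p * B = h₀ + q * E * D := by rw [h0]; ring
    have d1 := natDegree_mul hq hB0
    have d2 := natDegree_sub_le h₁ (p * E)
    have d3 := natDegree_mul_le (p := p) (q := E)
    rw [← e1] at d2
    have hp : p ≠ 0 := by
      rintro rfl
      rw [zero_mul, natDegree_zero] at d2
      omega
    have d4 := natDegree_mul hp hB0
    have d5 := natDegree_add_le h₀ (q * E * D)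
    have d6 := natDegree_mul_le (p := q * E) (q := D)
    have d7 := natDegree_mul_le (p := q) (q := E)
    rw [← e0] at d5
    omega

variable [CharZero k]

/-- The monomials `X ^ i * Y ^ j` with `i < 2`, `j < 3` are independent modulo the Jacobian ideal. -/
theorem eq_zero_of_mem_jacobianIdeal_unfolding {a b c d e g : k} {n : ℕ → ℕ → k}
    (h : MvPolynomial.C (n 0 0) + MvPolynomial.C (n 0 1) * .X 1 + MvPolynomial.C (n 0 2) * .X 1 ^ 2 +
      .X 0 * (MvPolynomial.C (n 1 0) + MvPolynomial.C (n 1 1) * .X 1 +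
        MvPolynomial.C (n 1 2) * .X 1 ^ 2) ∈ jacobianIdeal (unfolding a b c d e g)) :
    (n 0 0 = 0 ∧ n 0 1 = 0 ∧ n 0 2 = 0) ∧ n 1 0 = 0 ∧ n 1 1 = 0 ∧ n 1 2 = 0 := by
  rw [jacobianIdeal, Ideal.mem_span_pair, pderiv_zero_unfolding, pderiv_one_unfolding] at h
  obtain ⟨P, Q, h⟩ := h
  replace h := congrArg (toPoly 0) h
  have h10 : toPoly (k := k) 0 (.X 1) = C X := toPoly_X_of_ne (by decide)
  simp only [map_add, map_mul, map_pow, toPoly_X_self, h10, toPoly_C, map_ofNat] at h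
  set D : k[X] := C (3 : k)⁻¹ * (C a * X ^ 2 + C b * X + C c) with hD
  have h3 : (C (3 : k)⁻¹ : k[X]) * 3 = 1 := by
    rw [← map_ofNat C 3, ← C_mul, inv_mul_cancel₀ (by norm_num), C_1]
  have h3' : (C (C (3 : k)⁻¹) : k[X][X]) * 3 = 1 := by
    have := congrArg (C : k[X] → k[X][X]) h3
    rwa [C_mul, map_ofNat, C_1] at this
  set E : k[X] := C (2 * a) * X + C b with hE
  set B : k[X] := C 4 * X ^ 3 + C (2 * d) * X + C e with hB
  set M : k[X][X] := X ^ 2 + C D with hM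
  have hMm : M.Monic := by rw [hM]; monicity!
  have hMd : M.natDegree = 2 := by rw [hM]; compute_degree!
  -- Since `f_X = 3 M`, the multiplier of `f_Y = E X + B` matters only modulo `M`, so it may be
  -- taken as `q X + p`. Reducing its product with `f_Y` by `X^2 = -D` gives the pair `p B - q E D`,
  -- `p E + q B`.
  obtain ⟨q, p, hr⟩ := Polynomial.exists_eq_X_add_C_of_natDegree_le_one (p := toPoly 0 Q %ₘ M)
    (by have := natDegree_modByMonic_lt (toPoly 0 Q) hMm (fun h => by simp [h] at hMd); omega)
  have hQ := modByMonic_add_div (toPoly 0 Q) M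
  rw [hr] at hQ
  set h₀ : k[X] := C (n 0 0) + C (n 0 1) * X + C (n 0 2) * X ^ 2 with hh₀
  set h₁ : k[X] := C (n 1 0) + C (n 1 1) * X + C (n 1 2) * X ^ 2 with hh₁
  have hdvd : M ∣ C (h₁ - (p * E + q * B)) * X + C (h₀ - (p * B - q * E * D)) := by
    refine ⟨3 * toPoly 0 P + (toPoly 0 Q /ₘ M) * (X * C E + C B) + C (q * E), ?_⟩
    have hDD : (C D : k[X][X]) = C (C (3 : k)⁻¹) * (C (C a) * C X ^ 2 + C (C b) * C X + C (C c)) := by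
      simp [hD]
    have hM3 : (3 : k[X][X]) * M = 3 * X ^ 2 + (C (C a) * C X ^ 2 + C (C b) * C X + C (C c)) := by
      rw [hM, hDD]
      linear_combination (C (C a) * C X ^ 2 + C (C b) * C X + C (C c)) * h3'
    have hBE : X * C E + C B = X * (2 * C (C a) * C X + C (C b)) +
        (4 * C X ^ 3 + 2 * C (C d) * C X + C (C e)) := by
      simp only [hE, hB, map_add, map_mul, map_pow, map_ofNat]
    rw [← hM3, ← hBE] at h
    simp only [hh₀, hh₁, map_add, map_sub, map_mul, map_pow]
    linear_combination -h - (X * C E + C B) * hQ - C q * C E * hM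
  have hz : C (h₁ - (p * E + q * B)) * X + C (h₀ - (p * B - q * E * D)) = 0 := by
    refine eq_zero_of_dvd_of_natDegree_lt hdvd ?_
    rw [hMd]
    exact (natDegree_linear_le).trans_lt (by norm_num)
  have hz1 := congrArg (fun P => coeff P 1) hz
  have hz0 := congrArg (fun P => coeff P 0) hz
  simp [coeff_C] at hz1 hz0
  obtain ⟨e0, e1⟩ := eq_zero_of_natDegree_le_two (B := B) (D := D) (E := E) (p := p) (q := q)
    (by rw [hB]; compute_degree!) (by rw [hE]; compute_degree!) (by rw [hD]; compute_degree!)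
    (by rw [hh₀]; compute_degree!) (by rw [hh₁]; compute_degree!) (sub_eq_zero.1 hz0)
    (sub_eq_zero.1 hz1)
  refine ⟨⟨?_, ?_, ?_⟩, ?_, ?_, ?_⟩
  · simpa [hh₀, coeff_X, coeff_C] using congrArg (fun P => coeff P 0) e0
  · simpa [hh₀, coeff_X, coeff_C, coeff_X_pow] using congrArg (fun P => coeff P 1) e0
  · simpa [hh₀, coeff_X, coeff_C, coeff_X_pow] using congrArg (fun P => coeff P 2) e0
  · simpa [hh₁, coeff_X, coeff_C] using congrArg (fun P => coeff P 0) e1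
  · simpa [hh₁, coeff_X, coeff_C, coeff_X_pow] using congrArg (fun P => coeff P 1) e1
  · simpa [hh₁, coeff_X, coeff_C, coeff_X_pow] using congrArg (fun P => coeff P 2) e1

/-- Eliminating `x` between `f_X` and `f_Y` leaves a polynomial of degree 6 satisfied by `y`, and
`f_X = 0` makes `x^2` a polynomial in `y`. -/
theorem finite_quotient_jacobianIdeal_unfolding (a b c d e g : k) :
    Module.Finite k (MvPolynomial (Fin 2) k ⧸ jacobianIdeal (unfolding a b c d e g)) := by
  set J := jacobianIdeal (unfolding a b c d e g) with hJ
  set x := Ideal.Quotient.mk J (.X 0)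
  set y := Ideal.Quotient.mk J (.X 1)
  have hC (r : k) : Ideal.Quotient.mk J (MvPolynomial.C r) = algebraMap k _ r := rfl
  have hx : 3 * x ^ 2 + (algebraMap k _ a * y ^ 2 + algebraMap k _ b * y + algebraMap k _ c) = 0 := by
    have : Ideal.Quotient.mk J (MvPolynomial.pderiv 0 (unfolding a b c d e g)) = 0 :=
      Ideal.Quotient.eq_zero_iff_mem.2 (Ideal.subset_span (by simp))
    rw [pderiv_zero_unfolding] at this
    simpa only [map_add, map_mul, map_pow, map_ofNat, map_zero, hC] using this
  have hy : x * (2 * algebraMap k _ a * y + algebraMap k _ b) +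
      (4 * y ^ 3 + 2 * algebraMap k _ d * y + algebraMap k _ e) = 0 := by
    have : Ideal.Quotient.mk J (MvPolynomial.pderiv 1 (unfolding a b c d e g)) = 0 :=
      Ideal.Quotient.eq_zero_iff_mem.2 (Ideal.subset_span (by simp))
    rw [pderiv_one_unfolding] at this
    simpa only [map_add, map_mul, map_pow, map_ofNat, map_zero, hC] using this
  have hyint : IsIntegral k y := by
    refine IsAlgebraic.isIntegral ⟨3 * (4 * X ^ 3 + 2 * C d * X + C e) ^ 2 +
      (2 * C a * X + C b) ^ 2 * (C a * X ^ 2 + C b * X + C c), ?_, ?_⟩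
    · intro h0
      have h6 : (3 * (4 * X ^ 3 + 2 * C d * X + C e) ^ 2 +
          (2 * C a * X + C b) ^ 2 * (C a * X ^ 2 + C b * X + C c)).natDegree = 6 := by
        simp only [← map_ofNat (C : k →+* k[X]), ← C_mul]
        compute_degree!
      rw [h0, natDegree_zero] at h6
      exact absurd h6 (by norm_num)
    · simp only [map_add, map_mul, map_pow, aeval_X, aeval_C, map_ofNat]
      linear_combination (2 * algebraMap k _ a * y + algebraMap k _ b) ^ 2 * hx -
        3 * (x * (2 * algebraMap k _ a * y + algebraMap k _ b) - 
        (4 * y ^ 3 + 2 * algebraMap k _ d * y + algebraMap k _ e)) * hy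
  have h3 : (3 : MvPolynomial (Fin 2) k ⧸ J) * algebraMap k _ (3 : k)⁻¹ = 1 := by
    rw [← map_ofNat (algebraMap k _) 3, ← map_mul, mul_inv_cancel₀ (by norm_num), map_one]
  have hxint : IsIntegral k x := by
    refine IsIntegral.of_pow (n := 2) (by norm_num) ?_
    have : x ^ 2 = -(algebraMap k _ (3 : k)⁻¹ *
        (algebraMap k _ a * y ^ 2 + algebraMap k _ b * y + algebraMap k _ c)) := by
      linear_combination algebraMap k _ (3 : k)⁻¹ * hx - x ^ 2 * h3
    rw [this]
    have hi (r : k) : IsIntegral k (algebraMap k (MvPolynomial (Fin 2) k ⧸ J) r) :=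
      isIntegral_algebraMap
    exact ((hi _).mul ((((hi _).mul (hyint.pow 2)).add ((hi _).mul hyint)).add (hi _))).neg
  have : Algebra.IsIntegral k (MvPolynomial (Fin 2) k ⧸ J) := by
    refine ⟨fun z => ?_⟩
    obtain ⟨p, rfl⟩ := Ideal.Quotient.mk_surjective z
    induction p using MvPolynomial.induction_on with
    | C r => exact isIntegral_algebraMap (x := r)
    | add p q hp hq => rw [map_add]; exact hp.add hq
    | mul_X p i hp =>
      rw [map_mul]
      refine hp.mul ?_
      fin_cases i
      exacts [hxint, hyint]
  exact Algebra.IsIntegral.finite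

end

end PlaneCurve

/-! ### Equations for the parameters and their solutions -/

namespace PlaneCurve

open MvPolynomial

variable {k : Type*} [Field k] [CharZero k]

/-- Rank one of the multiplication by the unfolding, in coordinates. -/
theorem IsRankOne.unfolding_equations {a b c d e g : k} (h : IsRankOne (unfolding a b c d e g)) :
    (a ≠ 0 ∨ b ≠ 0 ∨ c ≠ 0 ∨ d ≠ 0 ∨ e ≠ 0 ∨ g ≠ 0) ∧ ∃ α β : k,
      (9 * e + a ^ 2 * b / 2 = 6 * d * β ∧ 5 * b = 2 * a * β ∧
        8 * c - 4 * a * d - a ^ 4 / 6 = 5 * b * β ∧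
        12 * g - 3 * d ^ 2 + a * b ^ 2 / 6 + a ^ 2 * c / 3 - a ^ 3 * d / 6 = 9 * e * β ∧
        -3 * b * d / 2 - a * e / 2 - a ^ 3 * b / 12 = 8 * c * β) ∧
      6 * d + a ^ 3 / 3 = 2 * a * α ∧ 12 * g + 7 * a * b ^ 2 / 12 = 8 * c * α := by
  obtain ⟨h1, p, hp⟩ := h
  set J := jacobianIdeal (unfolding a b c d e g) with hJ
  set F : MvPolynomial (Fin 2) k := 12 * C g + 9 * C e * X 1 + 6 * C d * X 1 ^ 2 +
    X 0 * (8 * C c + 5 * C b * X 1 + 2 * C a * X 1 ^ 2) with hF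
  have h0J : pderiv 0 (unfolding a b c d e g) ∈ J := Ideal.subset_span (by simp)
  have h1J : pderiv 1 (unfolding a b c d e g) ∈ J := Ideal.subset_span (by simp)
  -- Euler's identity for the weights 4 of `X` and 3 of `Y`: `X^3 + Y^4` has weight 12, so `12 f` is
  -- congruent to the combination `F` of basis monomials.
  have hEuler : 12 * unfolding a b c d e g = F + 4 * X 0 * pderiv 0 (unfolding a b c d e g) +
      3 * X 1 * pderiv 1 (unfolding a b c d e g) := by
    rw [pderiv_zero_unfolding, pderiv_one_unfolding, unfolding, hF]
    ring
  have hFJ (q : MvPolynomial (Fin 2) k) (hq : q * unfolding a b c d e g ∈ J) : q * F ∈ J := by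
    have : q * F = 12 * (q * unfolding a b c d e g) -
        (4 * q * X 0 * pderiv 0 (unfolding a b c d e g) +
          3 * q * X 1 * pderiv 1 (unfolding a b c d e g)) := by
      linear_combination -q * hEuler
    rw [this]
    exact sub_mem (Ideal.mul_mem_left _ _ hq)
      (add_mem (Ideal.mul_mem_left _ _ h0J) (Ideal.mul_mem_left _ _ h1J))
  refine ⟨?_, p 0, p 1, ?_⟩
  · by_contra! hz
    obtain ⟨rfl, rfl, rfl, rfl, rfl, rfl⟩ := hz
    have hF0 : F = 0 := by simp [hF]
    rw [hF0, zero_add] at hEuler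
    have h12 : 12 * unfolding (0 : k) 0 0 0 0 0 ∈ J := by
      rw [hEuler]
      exact add_mem (Ideal.mul_mem_left _ _ h0J) (Ideal.mul_mem_left _ _ h1J)
    have hu : IsUnit (12 : MvPolynomial (Fin 2) k) := by
      rw [← map_ofNat C 12]
      exact (IsUnit.mk0 (12 : k) (by norm_num)).map C
    exact h1 ((Ideal.unit_mul_mem_iff_mem J hu).1 h12)
  · have hX := hFJ _ (hp (X 0))
    have hY := hFJ _ (hp (X 1))
    rw [eval_X] at hX hY
    generalize p 0 = α at hX hY ⊢
    generalize p 1 = β at hX hY ⊢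
    -- The entries are the coordinates of `12 (Y - β) F` modulo `J`, the factor 12 clearing
    -- denominators. A wildcard stands for 1 as first index and for 2 as second.
    have eY := eq_zero_of_mem_jacobianIdeal_unfolding (a := a) (b := b) (c := c) (d := d) (e := e)
      (g := g) (n := fun i j => match i, j with
        | 0, 0 => -144 * g * β - 18 * d * e + 2 * a * b * c - a ^ 3 * e
        | 0, 1 => 144 * g - 108 * e * β - 36 * d ^ 2 + 2 * a * b ^ 2 + 4 * a ^ 2 * c -
          2 * a ^ 3 * d
        | 0, _ => 108 * e - 72 * d * β + 6 * a ^ 2 * b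
        | _, 0 => -96 * c * β - 18 * b * d - 6 * a * e - a ^ 3 * b
        | _, 1 => 96 * c - 60 * b * β - 48 * a * d - 2 * a ^ 4
        | _, _ => 60 * b - 24 * a * β) (by
      have : 12 * ((X 1 - C β) * F) -
          ((-2 * C a * C b - 4 * C a ^ 2 * X 1) * pderiv 0 (unfolding a b c d e g) +
            (18 * C d + 6 * C a * X 0 + C a ^ 3) * pderiv 1 (unfolding a b c d e g)) ∈ J :=
        sub_mem (Ideal.mul_mem_left _ _ hY)
          (add_mem (Ideal.mul_mem_left _ _ h0J) (Ideal.mul_mem_left _ _ h1J))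
      convert this using 1
      rw [pderiv_zero_unfolding, pderiv_one_unfolding, hF]
      simp only [map_add, map_sub, map_mul, map_pow, map_neg, map_ofNat]
      ring)
    have eX := eq_zero_of_mem_jacobianIdeal_unfolding (a := a) (b := b) (c := c) (d := d) (e := e)
      (g := g) (n := fun i j => match i, j with
        | 0, 0 => -144 * g * α - 32 * c ^ 2 + 7 * a * b * e
        | 0, 1 => -108 * e * α - 52 * b * c + 14 * a * b * d + 2 * a ^ 2 * e
        | 0, _ => -72 * d * α - 20 * b ^ 2 - 40 * a * c + 4 * a ^ 2 * d
        | _, 0 => 144 * g - 96 * c * α + 7 * a * b ^ 2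
        | _, 1 => 108 * e - 60 * b * α + 16 * a ^ 2 * b
        | _, _ => 72 * d - 24 * a * α + 4 * a ^ 3) (by
      have : 12 * ((X 0 - C α) * F) -
          ((32 * C c + 20 * C b * X 1 + 8 * C a * X 1 ^ 2) * pderiv 0 (unfolding a b c d e g) +
            (-7 * C a * C b - 2 * C a ^ 2 * X 1) * pderiv 1 (unfolding a b c d e g)) ∈ J :=
        sub_mem (Ideal.mul_mem_left _ _ hX)
          (add_mem (Ideal.mul_mem_left _ _ h0J) (Ideal.mul_mem_left _ _ h1J))
      convert this using 1
      rw [pderiv_zero_unfolding, pderiv_one_unfolding, hF]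
      simp only [map_add, map_sub, map_mul, map_pow, map_neg, map_ofNat]
      ring)
    obtain ⟨⟨-, y01, y02⟩, y10, y11, y12⟩ := eY
    obtain ⟨⟨-, -, -⟩, x10, -, x12⟩ := eX
    simp only at y01 y02 y10 y11 y12 x10 x12
    refine ⟨⟨?_, ?_, ?_, ?_, ?_⟩, ?_, ?_⟩
    · linear_combination y02 / 12
    · linear_combination y12 / 12
    · linear_combination y11 / 12
    · linear_combination y01 / 12
    · linear_combination y10 / 12
    · linear_combination x12 / 12
    · linear_combination x10 / 12

/-- The four types of unfoldings of rank one, up to the action of the multiplicative group. -/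
theorem IsRankOne.unfolding_cases {a b c d e g : k} (h : IsRankOne (unfolding a b c d e g)) :
    a ≠ 0 ∧ ∃ α β : k, (b = 2 / 5 * a * β ∧ c = a * β ^ 2 / 4 + a ^ 2 * α / 6 - a ^ 4 / 144 ∧
      d = a * α / 3 - a ^ 3 / 18 ∧ e = 2 / 9 * a * α * β - 8 / 135 * a ^ 3 * β ∧
      g = a * α * β ^ 2 / 6 + a ^ 2 * α ^ 2 / 9 - 7 / 900 * a ^ 3 * β ^ 2 - a ^ 4 * α / 216) ∧
      ((α = a ^ 2 / 36 ∧ β ^ 2 = 0) ∨ (α = -a ^ 2 / 12 ∧ β ^ 2 = 0) ∨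
        (α = a ^ 2 / 3 ∧ β ^ 2 = -25 / 108 * a ^ 3) ∨
        (α = 19 / 300 * a ^ 2 ∧ β ^ 2 = -32 / 3375 * a ^ 3)) := by
  obtain ⟨hne, α, β, ⟨h1, h2, h3, h4, h5⟩, h6, h7⟩ := h.unfolding_equations
  -- With `a = 0` the equations kill the remaining parameters in turn, leaving `X^3 + Y^4`, which
  -- lies in its own Jacobian ideal.
  have ha : a ≠ 0 := by
    rintro rfl
    have hb : b = 0 := by linear_combination h2 / 5
    have hd : d = 0 := by linear_combination h6 / 6
    subst hb hd
    have he : e = 0 := by linear_combination h1 / 9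
    subst he
    have hc : c = 0 := by linear_combination h3 / 8
    subst hc
    have hg : g = 0 := by linear_combination h4 / 12
    simp [hg] at hne
  have hb : b = 2 / 5 * a * β := by linear_combination h2 / 5
  have hd : d = a * α / 3 - a ^ 3 / 18 := by linear_combination h6 / 6
  subst hb hd
  have he : e = 2 / 9 * a * α * β - 8 / 135 * a ^ 3 * β := by linear_combination h1 / 9
  have hc : c = a * β ^ 2 / 4 + a ^ 2 * α / 6 - a ^ 4 / 144 := by linear_combination h3 / 8
  subst he hc
  have hg : g = a * α * β ^ 2 / 6 + a ^ 2 * α ^ 2 / 9 - 7 / 900 * a ^ 3 * β ^ 2 -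
    a ^ 4 * α / 216 := by linear_combination h7 / 12
  refine ⟨ha, α, β, ⟨rfl, rfl, rfl, rfl, hg⟩, ?_⟩
  subst hg
  have e1 : α ^ 2 + 11 / 20 * a * β ^ 2 + a ^ 2 * α / 18 - a ^ 4 / 432 = 0 := by
    refine mul_left_cancel₀ (pow_ne_zero 2 ha) ?_
    linear_combination h4
  have e2 : β * (2 * β ^ 2 + 74 / 45 * a * α - 23 / 270 * a ^ 3) = 0 := by
    refine mul_left_cancel₀ ha ?_
    linear_combination -h5
  rcases mul_eq_zero.1 e2 with hβ | hβ
  · subst hβ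
    have : (α - a ^ 2 / 36) * (α + a ^ 2 / 12) = 0 := by linear_combination e1
    rcases mul_eq_zero.1 this with h | h
    · exact Or.inl ⟨by linear_combination h, by ring⟩
    · exact Or.inr (Or.inl ⟨by linear_combination h, by ring⟩)
  -- Substituting `β^2` from the second equation into the first leaves a quadratic in `α`.
  · have : (α - a ^ 2 / 3) * (α - 19 / 300 * a ^ 2) = 0 := by
      linear_combination e1 - 11 / 40 * a * hβ
    rcases mul_eq_zero.1 this with h | h
    · exact Or.inr (Or.inr (Or.inl ⟨by linear_combination h,
        by linear_combination hβ / 2 - 37 / 45 * a * h⟩))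
    · exact Or.inr (Or.inr (Or.inr ⟨by linear_combination h,
        by linear_combination hβ / 2 - 37 / 45 * a * h⟩))

end PlaneCurve

/-! ### Explicit parametrizations -/

namespace PlaneCurve

open Polynomial

variable {k : Type*} [Field k]

theorem eval₂_toPoly_zero (u v : k[X]) (g : MvPolynomial (Fin 2) k) :
    eval₂ (compRingHom v) u (toPoly 0 g) = MvPolynomial.aeval ![u, v] g := by
  induction g using MvPolynomial.induction_on with
  | C c => rw [toPoly_C, eval₂_C, MvPolynomial.aeval_C, coe_compRingHom_apply, C_comp]; rfl
  | add p q hp hq => rw [map_add, map_add, eval₂_add, hp, hq]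
  | mul_X p l hp =>
    rw [map_mul, map_mul, eval₂_mul, hp, MvPolynomial.aeval_X]
    congr 1
    fin_cases l
    · change eval₂ _ _ (toPoly 0 (.X 0)) = u
      rw [toPoly_X_self, eval₂_X]
    · change eval₂ _ _ (toPoly 0 (.X 1)) = v
      rw [toPoly_X_of_ne (by decide), eval₂_C, coe_compRingHom_apply, X_comp]

/-- Polynomials of degree at most two in `u` over `k[v]` do not vanish, by their degrees. -/
theorem eq_zero_of_eval₂_eq_zero {u v : k[X]} (hu : u.natDegree = 4) (hv : v.natDegree = 3)
    {r : k[X][X]} (hr : r.natDegree < 3) (h : eval₂ (compRingHom v) u r = 0) : r = 0 := by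
  rw [eval₂_eq_sum_range' _ hr] at h
  have hu0 : u ≠ 0 := by rintro rfl; simp at hu
  have hvc (p : k[X]) : p.comp v = 0 → p = 0 := fun hp => by
    rcases comp_eq_zero_iff.1 hp with h | ⟨-, h⟩
    · exact h
    · rw [h, natDegree_C] at hv; omega
  have hdeg (i : ℕ) (hi : r.coeff i ≠ 0) :
      (compRingHom v (r.coeff i) * u ^ i).natDegree = 3 * (r.coeff i).natDegree + 4 * i := by
    rw [coe_compRingHom_apply, natDegree_mul (fun h => hi (hvc _ h)) (pow_ne_zero _ hu0),
      natDegree_comp, natDegree_pow, hu, hv]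
    ring
  have hne (i : ℕ) (hi : compRingHom v (r.coeff i) * u ^ i ≠ 0) : r.coeff i ≠ 0 := by
    rintro h; rw [h, map_zero, zero_mul] at hi; exact hi rfl
  -- The degrees `3 m + 4 i` with `i < 3` are distinct modulo 3, so nonzero terms cannot cancel.
  have hd := degree_sum_eq_of_disjoint (fun i => compRingHom v (r.coeff i) * u ^ i)
    (Finset.range 3) (by
      intro i hi j hj hij heq
      have h' := natDegree_eq_natDegree heq
      simp only at h'
      rw [hdeg i (hne i hi.2), hdeg j (hne j hj.2)] at h'
      have h1 := Finset.mem_range.1 hi.1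
      have h2 := Finset.mem_range.1 hj.1
      omega)
  rw [h, degree_zero, eq_comm, Finset.sup_eq_bot_iff] at hd
  ext1 i
  rw [coeff_zero]
  by_cases hi : i < 3
  · have := degree_eq_bot.1 (hd i (Finset.mem_range.2 hi))
    rw [coe_compRingHom_apply] at this
    exact hvc _ ((mul_eq_zero.1 this).resolve_right (pow_ne_zero _ hu0))
  · exact coeff_eq_zero_of_natDegree_lt (by omega)

theorem toPoly_unfolding (a b c d e g : k) : toPoly 0 (unfolding a b c d e g) =
    X ^ 3 + X * C (C a * X ^ 2 + C b * X + C c) + C (X ^ 4 + C d * X ^ 2 + C e * X + C g) := by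
  have h10 : toPoly (k := k) 0 (.X 1) = C X := toPoly_X_of_ne (by decide)
  simp only [unfolding, map_add, map_mul, map_pow, toPoly_X_self, h10, toPoly_C]
  ring

/-- The unfolding is monic of degree 3 in `X`; the remainder of a relation on division by it has
degree at most 2 in `X` and vanishes by the degree count. -/
theorem ker_aeval_eq_span_unfolding {a b c d e g : k} {u v : k[X]} (hu : u.natDegree = 4)
    (hv : v.natDegree = 3) (h : MvPolynomial.aeval ![u, v] (unfolding a b c d e g) = 0) :
    RingHom.ker (MvPolynomial.aeval ![u, v] : MvPolynomial (Fin 2) k →ₐ[k] k[X]) =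
      Ideal.span {unfolding a b c d e g} := by
  refine le_antisymm (fun x hx => ?_) ((Ideal.span_singleton_le_iff_mem _).2 h)
  rw [RingHom.mem_ker, ← eval₂_toPoly_zero] at hx
  rw [← eval₂_toPoly_zero] at h
  rw [Ideal.mem_span_singleton, ← map_dvd_iff (toPoly (k := k) 0)]
  have hm : (toPoly 0 (unfolding a b c d e g)).Monic := by
    rw [toPoly_unfolding]; monicity!
  have hd : (toPoly 0 (unfolding a b c d e g)).natDegree = 3 := by
    rw [toPoly_unfolding]; compute_degree!
  rw [← modByMonic_eq_zero_iff_dvd hm]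
  refine eq_zero_of_eval₂_eq_zero hu hv ?_ ?_
  · have := natDegree_modByMonic_lt (toPoly 0 x) hm (fun h => by simp [h] at hd)
    omega
  · rw [← modByMonic_add_div (toPoly 0 x) (toPoly 0 (unfolding a b c d e g)), eval₂_add, eval₂_mul,
      h, zero_mul, add_zero] at hx
    exact hx

/-- After an automorphism of the plane, the curve has the given parametric form. -/
def HasForm (f : MvPolynomial (Fin 2) k) (u v : k[X]) : Prop :=
  ∃ σ : MvPolynomial (Fin 2) k ≃ₐ[k] MvPolynomial (Fin 2) k, IsParametrizedBy (σ f) u v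

theorem HasForm.of_algEquiv {f : MvPolynomial (Fin 2) k} {u v : k[X]} {c : k} (hc : c ≠ 0)
    {σ : MvPolynomial (Fin 2) k ≃ₐ[k] MvPolynomial (Fin 2) k}
    (h : HasForm (MvPolynomial.C c * σ f) u v) : HasForm f u v := by
  obtain ⟨τ, h1, h2⟩ := h
  refine ⟨σ.trans τ, ?_, h2⟩
  rw [h1, map_mul, ← MvPolynomial.algebraMap_eq, AlgEquiv.commutes, AlgEquiv.trans_apply]
  exact Ideal.span_singleton_mul_left_unit ((IsUnit.mk0 c hc).map _) _

/-- With weights 2, 5, 8, 6, 9, 12 on `a, b, c, d, e, g` the unfolding is quasi-homogeneous of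
weight 12, so one polynomial identity settles a whole orbit. The sign of `u` matches `X^3 + Y^4`; `P
v + R` is the mean of `u` over the roots of `v`, which removes the quadratic terms in `X`, and `r`
removes `Y^3`. -/
theorem hasForm_unfolding {a b c d e g s P R r : k} (hs : s ≠ 0) {u v : k[X]}
    (hu : u.natDegree = 4) (hv : v.natDegree = 3)
    (h : MvPolynomial.aeval ![-u + C P * v + C R, v + C r] (unfolding a b c d e g) = 0)
    (hbir : IntermediateField.adjoin k
      {algebraMap (Polynomial k) (RatFunc k) u, algebraMap (Polynomial k) (RatFunc k) v} = ⊤) :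
    HasForm (unfolding (a * s ^ 2) (b * s ^ 5) (c * s ^ 8) (d * s ^ 6) (e * s ^ 9) (g * s ^ 12))
      u v := by
  set τ := affineEquiv (-s ^ 4) (s ^ 3) (s ^ 4 * P) (s ^ 4 * R) (s ^ 3 * r)
    (neg_ne_zero.2 (pow_ne_zero 4 hs)) (pow_ne_zero 3 hs)
  have hcomp : (MvPolynomial.aeval ![u, v]).comp τ.toAlgHom =
      MvPolynomial.aeval ![C (s ^ 4) * (-u + C P * v + C R), C (s ^ 3) * (v + C r)] := by
    refine MvPolynomial.algHom_ext fun i => ?_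
    fin_cases i
    · simp [τ, affineEquiv_X_zero, MvPolynomial.algHom_C]
      ring
    · simp [τ, affineEquiv_X_one, MvPolynomial.algHom_C]
      ring
  have hker := ker_aeval_eq_span_unfolding (a := a * s ^ 2) (b := b * s ^ 5) (c := c * s ^ 8)
    (d := d * s ^ 6) (e := e * s ^ 9) (g := g * s ^ 12)
    (u := C (s ^ 4) * (-u + C P * v + C R)) (v := C (s ^ 3) * (v + C r)) (by
      rw [natDegree_C_mul (pow_ne_zero 4 hs), natDegree_add_C,
        natDegree_add_eq_left_of_natDegree_lt, natDegree_neg, hu]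
      rw [natDegree_neg]
      have := natDegree_C_mul_le P v
      omega) (by rw [natDegree_C_mul (pow_ne_zero 3 hs), natDegree_add_C, hv]) (by
      have : MvPolynomial.aeval ![C (s ^ 4) * (-u + C P * v + C R), C (s ^ 3) * (v + C r)]
          (unfolding (a * s ^ 2) (b * s ^ 5) (c * s ^ 8) (d * s ^ 6) (e * s ^ 9) (g * s ^ 12)) =
          C s ^ 12 *
            MvPolynomial.aeval ![-u + C P * v + C R, v + C r] (unfolding a b c d e g) := by
        simp [unfolding, MvPolynomial.algHom_C]
        ring
      rw [this, h, mul_zero])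
  refine ⟨τ, ?_, hbir⟩
  ext x
  obtain ⟨x, rfl⟩ := τ.surjective x
  have hx : MvPolynomial.aeval ![u, v] (τ x) =
      MvPolynomial.aeval ![C (s ^ 4) * (-u + C P * v + C R), C (s ^ 3) * (v + C r)] x :=
    DFunLike.congr_fun hcomp x
  rw [RingHom.mem_ker, hx, ← RingHom.mem_ker, hker, Ideal.mem_span_singleton,
    Ideal.mem_span_singleton, map_dvd_iff]

/-- A square root `s` of `a / a₀` determines `β` up to sign; replacing `s` by `-s` corrects the sign
without changing `s ^ 2`. -/
theorem exists_scaling [IsAlgClosed k] {a a₀ β β₀ : k} (ha₀ : a₀ ≠ 0)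
    (h : β ^ 2 * a₀ ^ 3 = β₀ ^ 2 * a ^ 3) : ∃ s, a = a₀ * s ^ 2 ∧ β = β₀ * s ^ 3 := by
  obtain ⟨s, hs⟩ := IsAlgClosed.exists_pow_nat_eq (a / a₀) (n := 2) (by norm_num)
  have has : a = a₀ * s ^ 2 := by rw [hs, mul_div_cancel₀ _ ha₀]
  have hsq : β ^ 2 = (β₀ * s ^ 3) ^ 2 := by
    refine mul_right_cancel₀ (pow_ne_zero 3 ha₀) ?_
    rw [h, has]
    ring
  rcases sq_eq_sq_iff_eq_or_eq_neg.1 hsq with h | h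
  · exact ⟨s, has, h⟩
  · exact ⟨-s, by rw [has]; ring, by rw [h]; ring⟩

theorem adjoin_eq_top_of_X_mem {S : Set (RatFunc k)} (h : RatFunc.X ∈ IntermediateField.adjoin k S) :
    IntermediateField.adjoin k S = ⊤ := by
  rw [eq_top_iff, ← RatFunc.adjoin_X]
  exact IntermediateField.adjoin_le_iff.2 (Set.singleton_subset_iff.2 h)

theorem adjoin_cuspidal_eq_top (a : k) : IntermediateField.adjoin k
    {algebraMap (Polynomial k) (RatFunc k) (X ^ 4 + C a * X ^ 2),
      algebraMap (Polynomial k) (RatFunc k) (X ^ 3 - 3 * X ^ 2)} = ⊤ := by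
  refine adjoin_eq_top_of_X_mem ?_
  set S := IntermediateField.adjoin k {algebraMap (Polynomial k) (RatFunc k) (X ^ 4 + C a * X ^ 2),
      algebraMap (Polynomial k) (RatFunc k) (X ^ 3 - 3 * X ^ 2)}
  set x := algebraMap (Polynomial k) (RatFunc k) (X ^ 4 + C a * X ^ 2) with hx
  set y := algebraMap (Polynomial k) (RatFunc k) (X ^ 3 - 3 * X ^ 2) with hy
  have hxS : x ∈ S := IntermediateField.subset_adjoin _ _ (Set.mem_insert _ _)
  have hyS : y ∈ S := IntermediateField.subset_adjoin _ _ (Set.mem_insert_of_mem _ rfl)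
  set α := algebraMap (Polynomial k) (RatFunc k) (C a)
  have hαS : α ∈ S := by
    have := S.algebraMap_mem a
    rwa [IsScalarTower.algebraMap_apply k k[X] (RatFunc k)] at this
  set t : RatFunc k := RatFunc.X
  have hX : algebraMap (Polynomial k) (RatFunc k) X = t := RatFunc.algebraMap_X
  simp only [map_add, map_sub, map_mul, map_pow, hX, map_ofNat] at hx hy
  have hδ : y ^ 2 + (9 + α) * x ≠ 0 := by
    have : y ^ 2 + (9 + α) * x = algebraMap (Polynomial k) (RatFunc k)
        (X ^ 6 - 6 * X ^ 5 + (18 + C a) * X ^ 4 + (9 + C a) * C a * X ^ 2) := by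
      simp only [map_add, map_sub, map_mul, map_pow, hX, map_ofNat]
      rw [hx, hy]
      ring
    rw [this, map_ne_zero_iff _ (RatFunc.algebraMap_injective k)]
    intro h0
    have h6 : (X ^ 6 - 6 * X ^ 5 + (18 + C a) * X ^ 4 + (9 + C a) * C a * X ^ 2 :
        k[X]).natDegree = 6 := by
      compute_degree!
    rw [h0, natDegree_zero] at h6
    exact absurd h6 (by norm_num)
  -- Euclid's algorithm on `T^4 + a T^2 - x` and `T^3 - 3 T^2 - y`, whose common root is `t`, ends
  -- in the linear remainder solved here.
  have ht : t = ((x - 3 * y) * (y + 27 + 3 * α) + (9 + α) ^ 2 * y) / (y ^ 2 + (9 + α) * x) := by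
    rw [eq_div_iff hδ, hx, hy]
    ring
  rw [ht]
  have h3 : (3 : RatFunc k) ∈ S := ofNat_mem S 3
  have h9 : 9 + α ∈ S := add_mem (ofNat_mem S 9) hαS
  have hxy : x - 3 * y ∈ S := sub_mem hxS (mul_mem h3 hyS)
  have hyα : y + 27 + 3 * α ∈ S := add_mem (add_mem hyS (ofNat_mem S 27)) (mul_mem h3 hαS)
  exact div_mem (add_mem (mul_mem hxy hyα) (mul_mem (pow_mem h9 2) hyS))
    (add_mem (pow_mem hyS 2) (mul_mem h9 hxS))

theorem adjoin_tacnodal_eq_top : IntermediateField.adjoin k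
    {algebraMap (Polynomial k) (RatFunc k) ((X ^ 2 - 1) * (X ^ 2 + C (-1))),
      algebraMap (Polynomial k) (RatFunc k) ((X ^ 2 - 1) * (X + C 0))} = ⊤ := by
  refine adjoin_eq_top_of_X_mem ?_
  set S := IntermediateField.adjoin k
    {algebraMap (Polynomial k) (RatFunc k) ((X ^ 2 - 1) * (X ^ 2 + C (-1))),
      algebraMap (Polynomial k) (RatFunc k) ((X ^ 2 - 1) * (X + C 0))}
  set x := algebraMap (Polynomial k) (RatFunc k) ((X ^ 2 - 1) * (X ^ 2 + C (-1))) with hx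
  set y := algebraMap (Polynomial k) (RatFunc k) ((X ^ 2 - 1) * (X + C 0)) with hy
  have hxS : x ∈ S := IntermediateField.subset_adjoin _ _ (Set.mem_insert _ _)
  have hyS : y ∈ S := IntermediateField.subset_adjoin _ _ (Set.mem_insert_of_mem _ rfl)
  set t : RatFunc k := RatFunc.X
  have hX : algebraMap (Polynomial k) (RatFunc k) X = t := RatFunc.algebraMap_X
  have ht : t ^ 2 - 1 ≠ 0 := by
    have : t ^ 2 - 1 = algebraMap (Polynomial k) (RatFunc k) (X ^ 2 - C 1) := by
      simp only [map_sub, map_pow, hX, map_one]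
    rw [this, map_ne_zero_iff _ (RatFunc.algebraMap_injective k)]
    exact (monic_X_pow_sub_C 1 (by norm_num)).ne_zero
  simp only [map_add, map_sub, map_mul, map_pow, map_neg, map_one, map_zero, hX] at hx hy
  have hx' : x = (t ^ 2 - 1) ^ 2 := by rw [hx]; ring
  have hy' : y = (t ^ 2 - 1) * t := by rw [hy]; ring
  have hyx : y ^ 2 / x - 1 = t ^ 2 - 1 := by
    rw [hx', hy']; field_simp
  have : t = y / (y ^ 2 / x - 1) := by
    rw [hyx, hy', mul_div_cancel_left₀ _ ht]
  rw [this]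
  exact div_mem hyS (sub_mem (div_mem (pow_mem hyS 2) hxS) (one_mem S))

/-- The classification of the curves of bidegree `(3, 4)` with multiplication by `f` of rank one on
the Milnor algebra. -/
theorem IsRankOne.hasForm_of_unfolding [IsAlgClosed k] [CharZero k] {a b c d e g : k}
    (h : IsRankOne (unfolding a b c d e g)) :
    (∃ l : k, (l = 0 ∨ l = -8 ∨ l = -9) ∧
      HasForm (unfolding a b c d e g) (X ^ 4 + C l * X ^ 2) (X ^ 3 - 3 * X ^ 2)) ∨
    HasForm (unfolding a b c d e g) ((X ^ 2 - 1) * (X ^ 2 + C (-1))) ((X ^ 2 - 1) * (X + C 0)) := by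
  obtain ⟨ha, α, β, ⟨rfl, rfl, rfl, rfl, rfl⟩, hcases⟩ := h.unfolding_cases
  have hu (l : k) : (X ^ 4 + C l * X ^ 2).natDegree = 4 := by compute_degree!
  have hv : (X ^ 3 - 3 * X ^ 2 : k[X]).natDegree = 3 := by compute_degree!
  rcases hcases with ⟨rfl, hβ⟩ | ⟨rfl, hβ⟩ | ⟨rfl, hβ⟩ | ⟨rfl, hβ⟩
  -- In each case `a₀, β₀` are the values of `a, β` for the normalized curve, and the scaling
  -- carries it to the given solution.
  · obtain ⟨s, rfl, rfl⟩ := exists_scaling (a := a) (a₀ := -6) (β := β) (β₀ := 0) (by norm_num)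
      (by rw [hβ]; ring)
    have hs : s ≠ 0 := by rintro rfl; simp at ha
    refine Or.inl ⟨-8, by simp, ?_⟩
    convert hasForm_unfolding (a := -6) (b := 0) (c := -3) (d := 10) (e := 0) (g := -2) (P := 4)
      (R := 3) (r := 2) hs (hu (-8)) hv ?_ (adjoin_cuspidal_eq_top (-8)) using 2
    · ring
    · ring
    · ring
    · ring
    · ring
    · simp [unfolding, MvPolynomial.algHom_C]
      simp only [map_ofNat]
      ring
  · obtain ⟨s, rfl, rfl⟩ := exists_scaling (a := a) (a₀ := 2) (β := β) (β₀ := 0) (by norm_num)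
      (by rw [hβ]; ring)
    have hs : s ≠ 0 := by rintro rfl; simp at ha
    refine Or.inr ?_
    -- Writing the fraction as `w` turns the identity in `k[X]` into a multiple of `3 w = 1`.
    obtain ⟨w, hw⟩ : ∃ w : k, 3 * w = 1 := ⟨1 / 3, by norm_num⟩
    have hw' : w = 1 / 3 := by linear_combination hw / 3
    convert hasForm_unfolding (a := 2) (b := 0) (c := -w) (d := -2 * w) (e := 0) (g := 2 * w ^ 3)
      (P := 0) (R := w) (r := 0) hs (by compute_degree!) (by compute_degree!) ?_
      adjoin_tacnodal_eq_top using 2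
    · ring
    · rw [hw']; ring
    · rw [hw']; ring
    · ring
    · rw [hw']; ring
    · replace hw := congrArg (C : k → k[X]) hw
      simp [unfolding, MvPolynomial.algHom_C] at hw ⊢
      simp only [map_ofNat] at hw ⊢
      linear_combination ((X ^ 2 - 1) ^ 4 - C w * (X ^ 2 - 1) ^ 2 + C w ^ 2) * hw
  · obtain ⟨s, rfl, rfl⟩ := exists_scaling (a := a) (a₀ := -3) (β := β) (β₀ := -5 / 2)
      (by norm_num) (by rw [hβ]; ring)
    have hs : s ≠ 0 := by rintro rfl; simp at ha
    refine Or.inl ⟨-9, by simp, ?_⟩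
    obtain ⟨w, hw⟩ : ∃ w : k, 2 * w = 1 := ⟨1 / 2, by norm_num⟩
    have hw' : w = 1 / 2 := by linear_combination hw / 2
    convert hasForm_unfolding (a := -3) (b := 3) (c := -3 * w ^ 2) (d := -3 * w) (e := 1)
      (g := -3 * w ^ 4) (P := 4) (R := 0) (r := w) hs (hu (-9)) hv ?_
      (adjoin_cuspidal_eq_top (-9)) using 2
    · ring
    · rw [hw']; ring
    · rw [hw']; ring
    · ring
    · rw [hw']; ring
    · replace hw := congrArg (C : k → k[X]) hw
      simp [unfolding, MvPolynomial.algHom_C] at hw ⊢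
      simp only [map_ofNat] at hw ⊢
      linear_combination (-(3 * (X ^ 3 - 3 * X ^ 2) + 3 * C w) *
          (-(X ^ 4 - 9 * X ^ 2) + 4 * (X ^ 3 - 3 * X ^ 2)) + 2 * (X ^ 3 - 3 * X ^ 2) ^ 3 +
        3 * C w * (X ^ 3 - 3 * X ^ 2) ^ 2 + (X ^ 3 - 3 * X ^ 2) * (2 * C w ^ 2 - 2 * C w - 1) -
        C w * (C w + 1) ^ 2) * hw
  · obtain ⟨s, rfl, rfl⟩ := exists_scaling (a := a) (a₀ := -30) (β := β) (β₀ := -16)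
      (by norm_num) (by rw [hβ]; ring)
    have hs : s ≠ 0 := by rintro rfl; simp at ha
    refine Or.inl ⟨0, by simp, ?_⟩
    convert hasForm_unfolding (a := -30) (b := 192) (c := 1005) (d := 930) (e := -19520)
      (g := 91950) (P := 4) (R := 27) (r := 14) hs (hu 0) hv ?_
      (adjoin_cuspidal_eq_top 0) using 2
    · ring
    · ring
    · ring
    · ring
    · ring
    · simp [unfolding, MvPolynomial.algHom_C]
      simp only [map_ofNat]
      ring

end PlaneCurve

/-! ### Singular branches of a parametrized curve -/

namespace PlaneCurve

open Polynomial

variable {k : Type*} [Field k] {f : MvPolynomial (Fin 2) k} [hf : Fact (Irreducible f)]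

/-- A parametrization identifies the function field with the rational functions. -/
theorem IsParametrizedBy.exists_algEquiv
    {σ : MvPolynomial (Fin 2) k ≃ₐ[k] MvPolynomial (Fin 2) k} {u v : k[X]}
    (h : IsParametrizedBy (σ f) u v) : ∃ e : FunctionField f ≃ₐ[k] RatFunc k,
      ∀ g, e (toFunctionField f g) = algebraMap k[X] (RatFunc k) (MvPolynomial.aeval ![u, v] (σ g)) := by
  obtain ⟨hker, hadj⟩ := h
  have hmem (g : MvPolynomial (Fin 2) k) :
      MvPolynomial.aeval ![u, v] (σ g) = 0 ↔ g ∈ Ideal.span {f} := by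
    rw [← RingHom.mem_ker, hker, Ideal.mem_span_singleton, Ideal.mem_span_singleton, map_dvd_iff]
  let φ : CoordRing f →ₐ[k] RatFunc k :=
    (IsScalarTower.toAlgHom k k[X] (RatFunc k)).comp
      (Ideal.Quotient.liftₐ (Ideal.span {f}) ((MvPolynomial.aeval ![u, v]).comp σ.toAlgHom)
        fun g hg => (hmem g).2 hg)
  have hφ (g : MvPolynomial (Fin 2) k) : φ (Ideal.Quotient.mk _ g) =
      algebraMap k[X] (RatFunc k) (MvPolynomial.aeval ![u, v] (σ g)) := rfl
  have hinj : Function.Injective φ := by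
    rw [injective_iff_map_eq_zero]
    intro r hr
    obtain ⟨g, rfl⟩ := Ideal.Quotient.mk_surjective r
    rw [hφ, map_eq_zero_iff _ (RatFunc.algebraMap_injective k), hmem] at hr
    exact Ideal.Quotient.eq_zero_iff_mem.2 hr
  let L : FunctionField f →ₐ[k] RatFunc k := IsFractionRing.liftAlgHom hinj
  have hL (g : MvPolynomial (Fin 2) k) : L (toFunctionField f g) =
      algebraMap k[X] (RatFunc k) (MvPolynomial.aeval ![u, v] (σ g)) := by
    rw [← hφ, toFunctionField_apply]
    exact IsFractionRing.lift_algebraMap hinj _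
  have hsurj : Function.Surjective L := by
    rw [← AlgHom.fieldRange_eq_top, eq_top_iff, ← hadj, IntermediateField.adjoin_le_iff]
    rintro _ (rfl | rfl)
    · exact ⟨toFunctionField f (σ.symm (.X 0)), (hL _).trans (by
        rw [AlgEquiv.apply_symm_apply, MvPolynomial.aeval_X]; rfl)⟩
    · exact ⟨toFunctionField f (σ.symm (.X 1)), (hL _).trans (by
        rw [AlgEquiv.apply_symm_apply, MvPolynomial.aeval_X]; rfl)⟩
  exact ⟨AlgEquiv.ofBijective L ⟨L.toRingHom.injective, hsurj⟩, hL⟩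

/-- `k + X^2 k[X]` is a subalgebra, so criticality at 0 passes from the coordinates to the whole
coordinate ring. -/
theorem exists_aeval_eq_C_add {u v : k[X]} (hu : ∃ c r, u = C c + X ^ 2 * r)
    (hv : ∃ c r, v = C c + X ^ 2 * r) (g : MvPolynomial (Fin 2) k) :
    ∃ c r, MvPolynomial.aeval ![u, v] g = C c + X ^ 2 * r := by
  induction g using MvPolynomial.induction_on with
  | C c => exact ⟨c, 0, by simp [MvPolynomial.algHom_C]⟩
  | add p q hp hq =>
    obtain ⟨c, r, hr⟩ := hp
    obtain ⟨d, s, hs⟩ := hq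
    exact ⟨c + d, r + s, by rw [map_add, hr, hs, C_add]; ring⟩
  | mul_X p i hp =>
    obtain ⟨c, r, hr⟩ := hp
    have : ∃ d s, ![u, v] i = C d + X ^ 2 * s := by
      fin_cases i
      exacts [hu, hv]
    obtain ⟨d, s, hs⟩ := this
    exact ⟨c * d, C c * s + r * C d + X ^ 2 * r * s, by
      rw [map_mul, hr, MvPolynomial.aeval_X, hs, C_mul]; ring⟩

/-- If both coordinates of the parametrization are critical at `0`, there is a cuspidal branch. -/
theorem exists_isSingularBranch {σ : MvPolynomial (Fin 2) k ≃ₐ[k] MvPolynomial (Fin 2) k}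
    {u v : k[X]} (h : IsParametrizedBy (σ f) u v) (hu : ∃ c r, u = C c + X ^ 2 * r)
    (hv : ∃ c r, v = C c + X ^ 2 * r) : ∃ V, IsSingularBranch f V := by
  obtain ⟨e, he⟩ := h.exists_algEquiv
  have hX : Ideal.span {(X : k[X])} ≠ ⊤ := by
    rw [Ne, Ideal.span_singleton_eq_top]
    exact not_isUnit_X
  let A : Subring (FunctionField f) :=
    ((e.symm : RatFunc k →+* FunctionField f).comp (algebraMap k[X] (RatFunc k))).range
  let ψ : k[X] ≃+* A := RingEquiv.ofBijective
    ((e.symm : RatFunc k →+* FunctionField f).comp (algebraMap k[X] (RatFunc k))).rangeRestrict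
    ⟨fun a b hab => RatFunc.algebraMap_injective k (e.symm.injective (congrArg Subtype.val hab)),
      RingHom.rangeRestrict_surjective _⟩
  have hψ (p : k[X]) : (ψ p : FunctionField f) = e.symm (algebraMap k[X] (RatFunc k) p) := rfl
  -- `V` is a valuation ring containing `k[t]` with `t` in its maximal ideal.
  obtain ⟨V, hAV, hV⟩ := Ideal.image_subset_nonunits_valuationSubring
    ((Ideal.span {(X : k[X])}).comap (ψ.symm : A →+* k[X])) (by
      rw [Ne, Ideal.comap_eq_top_iff]; exact hX)
  have hpV (p : k[X]) : e.symm (algebraMap k[X] (RatFunc k) p) ∈ V := hAV (hψ p ▸ (ψ p).2)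
  set t := e.symm (algebraMap k[X] (RatFunc k) X) with ht
  have htV : V.valuation t < 1 := by
    refine V.mem_nonunits_iff.1 (hV ⟨ψ X, ?_, hψ X⟩)
    simp
  have hrange (g : MvPolynomial (Fin 2) k) : toFunctionField f g =
      e.symm (algebraMap k[X] (RatFunc k) (MvPolynomial.aeval ![u, v] (σ g))) := by
    rw [← he, AlgEquiv.symm_apply_apply]
  have hk (c : k) : algebraMap k (FunctionField f) c ∈ V := by
    have := hpV (C c)
    rwa [← algebraMap_eq, ← IsScalarTower.algebraMap_apply, AlgEquiv.commutes] at this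
  have htriv := ValuationSubring.isTrivialOn_valuation hk
  have ht0 : t ≠ 0 := by
    simp [ht, RatFunc.X_ne_zero]
  refine ⟨V, ⟨⟨hk, ?_⟩, fun r => ?_⟩, fun r hr hrm => ?_⟩
  · rintro rfl
    have := (ValuationSubring.valuation_le_one_iff _ _).2 (ValuationSubring.mem_top t⁻¹)
    rw [map_inv₀] at this
    exact absurd htV (not_lt.2 ((inv_le_one₀ (zero_lt_iff.2
      ((Valuation.ne_zero_iff _).2 ht0))).1 this))
  · obtain ⟨g, rfl⟩ := Ideal.Quotient.mk_surjective r
    rw [← toFunctionField_apply, hrange]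
    exact hpV _
  · obtain ⟨g, rfl⟩ := Ideal.Quotient.mk_surjective r
    obtain ⟨c, s, hs⟩ := exists_aeval_eq_C_add hu hv (σ g)
    have hr' := hrange g
    rw [hs, map_add, map_add, map_mul, map_mul, map_pow, map_pow, ← ht, ← algebraMap_eq,
      ← IsScalarTower.algebraMap_apply, AlgEquiv.commutes] at hr'
    have hc : c = 0 := by
      by_contra hc
      have h1 := V.valuation_lt_one_iff _ |>.1 hrm
      have h2 : V.valuation (t ^ 2 * e.symm (algebraMap k[X] (RatFunc k) s)) < 1 := by
        rw [map_mul, map_pow]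
        exact mul_lt_one_of_lt_of_le (pow_lt_one₀ zero_le htV two_ne_zero)
          ((V.valuation_le_one_iff _).2 (hpV s))
      have h3 : V.valuation (algebraMap k (FunctionField f) c) < 1 := by
        have : algebraMap k (FunctionField f) c = toFunctionField f g -
            t ^ 2 * e.symm (algebraMap k[X] (RatFunc k) s) := by rw [hr']; ring
        rw [this]
        exact (Valuation.map_sub _ _ _).trans_lt (max_lt h1 h2)
      exact h3.ne (htriv.eq_one c hc)
    rw [hc, map_zero, zero_add] at hr'
    have htm : (⟨t, hpV X⟩ : V) ∈ IsLocalRing.maximalIdeal V := (V.valuation_lt_one_iff _).2 htV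
    have : (⟨algebraMap (CoordRing f) (FunctionField f) (Ideal.Quotient.mk _ g), hr⟩ : V) =
        ⟨t, hpV X⟩ ^ 2 * ⟨e.symm (algebraMap k[X] (RatFunc k) s), hpV s⟩ := Subtype.ext hr'
    rw [this]
    exact Ideal.mul_mem_right _ _ (Ideal.pow_mem_pow htm 2)

/-- If the parametrization is an immersion, there is no cuspidal branch. -/
theorem not_isSingularBranch [IsAlgClosed k]
    {σ : MvPolynomial (Fin 2) k ≃ₐ[k] MvPolynomial (Fin 2) k}
    {u v : k[X]} (h : IsParametrizedBy (σ f) u v) (hu : u.natDegree ≠ 0)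
    (huv : ∀ c, u.derivative.eval c ≠ 0 ∨ v.derivative.eval c ≠ 0)
    (V : ValuationSubring (FunctionField f)) : ¬ IsSingularBranch f V := by
  rintro ⟨⟨⟨hk, htop⟩, hR⟩, hsing⟩
  obtain ⟨e, he⟩ := h.exists_algEquiv
  have hrange (g : MvPolynomial (Fin 2) k) :
      e.symm (algebraMap k[X] (RatFunc k) (MvPolynomial.aeval ![u, v] g)) =
        toFunctionField f (σ.symm g) := by
    rw [AlgEquiv.symm_apply_eq, he, AlgEquiv.apply_symm_apply]
  let w : Valuation k[X] V.ValueGroup :=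
    V.valuation.comap ((e.symm : RatFunc k →+* FunctionField f).comp (algebraMap k[X] (RatFunc k)))
  have hw (p : k[X]) : w p = V.valuation (e.symm (algebraMap k[X] (RatFunc k) p)) := rfl
  have htriv := ValuationSubring.isTrivialOn_valuation hk
  have hwC (c : k) (hc : c ≠ 0) : w (C c) = 1 := by
    rw [hw, ← algebraMap_eq, ← IsScalarTower.algebraMap_apply, AlgEquiv.commutes]
    exact htriv.eq_one c hc
  have hwtriv : w.IsTrivialOn k := ⟨fun c hc => hwC c hc⟩
  have hwR (g : MvPolynomial (Fin 2) k) : w (MvPolynomial.aeval ![u, v] g) ≤ 1 := by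
    rw [hw, hrange, V.valuation_le_one_iff]
    exact hR _
  -- A pole of `t` would be a pole of `u`, which lies in the coordinate ring and hence in `V`.
  have hX : w X ≤ 1 := by
    by_contra hlt
    have h1 := valuation_aeval_eq_valuation_X_pow_natDegree_of_one_lt_valuation_X (A := k) (v := w)
      X (not_le.1 hlt) (p := u) (by rintro rfl; simp at hu)
    rw [aeval_X_left_apply] at h1
    have h2 := hwR (.X 0)
    rw [MvPolynomial.aeval_X] at h2
    change w u ≤ 1 at h2
    rw [h1] at h2
    exact absurd h2 (not_le.2 (one_lt_pow₀ (not_le.1 hlt) hu))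
  have hpoly (p : k[X]) : w p ≤ 1 := by
    induction p using Polynomial.induction_on' with
    | add p q hp hq => exact (Valuation.map_add _ _ _).trans (max_le hp hq)
    | monomial n a =>
      rw [← C_mul_X_pow_eq_monomial, map_mul, map_pow]
      refine mul_le_one' ?_ (pow_le_one₀ zero_le hX)
      by_cases ha : a = 0
      · simp [ha]
      · exact (hwC a ha).le
  have hw0 (p : k[X]) (hp : p ≠ 0) : w p ≠ 0 := by
    rw [hw, Valuation.ne_zero_iff]
    simpa using hp
  -- Otherwise all linear factors, hence all nonzero polynomials, are units and `V` is the whole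
  -- field.
  obtain ⟨c, hc⟩ : ∃ c : k, w (X - C c) < 1 := by
    by_contra! hcon
    refine htop (SetLike.ext fun z => ⟨fun _ => ValuationSubring.mem_top _, fun _ => ?_⟩)
    have hunit (q : k[X]) (hq : q ≠ 0) : w q = 1 := by
      rw [(IsAlgClosed.splits q).eq_prod_roots, map_mul, map_multiset_prod, Multiset.map_map,
        hwC _ (leadingCoeff_ne_zero.2 hq), one_mul]
      refine Multiset.prod_eq_one fun x hx => ?_
      obtain ⟨c, -, rfl⟩ := Multiset.mem_map.1 hx
      exact le_antisymm (hpoly _) (hcon c)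
    rw [← V.valuation_le_one_iff, ← e.symm_apply_apply z, ← RatFunc.num_div_denom (e z), map_div₀,
      map_div₀, ← hw, ← hw, hunit _ (RatFunc.denom_ne_zero _), div_one]
    exact hpoly _
  set γ := w (X - C c) with hγ
  have hγ0 : γ ≠ 0 := hw0 _ (X_sub_C_ne_zero c)
  have hdvd (p : k[X]) (hp : p.eval c = 0) : w p ≤ γ := by
    obtain ⟨q, rfl⟩ := dvd_iff_isRoot.2 hp
    rw [map_mul]
    exact mul_le_of_le_one_right' (hpoly q)
  have hval (p : k[X]) (hp : p.eval c ≠ 0) : w p = 1 := by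
    have h1 : w (p - C (p.eval c)) < 1 := (hdvd _ (by simp)).trans_lt hc
    have h2 := w.map_add_eq_of_lt_right (h1.trans_eq (hwC _ hp).symm)
    rwa [sub_add_cancel, hwC _ hp] at h2
  -- `γ` is the largest value below one, so the square of the maximal ideal has values at most `γ *
  -- γ`. A coordinate with nonzero derivative at `c`, shifted to vanish there, has value exactly
  -- `γ`.
  have hmax (z : FunctionField f) (hz : V.valuation z < 1) : V.valuation z ≤ γ := by
    rw [← e.symm_apply_apply z, ← RatFunc.num_div_denom (e z), map_div₀, map_div₀, ← hw,
      ← hw] at hz ⊢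
    have hq : (RatFunc.denom (e z)).eval c ≠ 0 := by
      intro hq
      have hp : (RatFunc.num (e z)).eval c ≠ 0 := by
        intro hp
        obtain ⟨a, b, hab⟩ := RatFunc.isCoprime_num_denom (e z)
        have := congrArg (eval c) hab
        simp [hp, hq] at this
      rw [hval _ hp, one_div] at hz
      exact absurd hz (not_lt.2 ((one_le_inv₀ (zero_lt_iff.2
        (hw0 _ (RatFunc.denom_ne_zero _)))).2 (hpoly _)))
    rw [hval _ hq, div_one] at hz ⊢
    refine hdvd _ ?_
    by_contra hp
    exact hz.ne (hval _ hp)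
  have hsq (z : V) (hz : z ∈ IsLocalRing.maximalIdeal V ^ 2) :
      V.valuation (z : FunctionField f) ≤ γ * γ := by
    rw [pow_two] at hz
    induction hz using Submodule.mul_induction_on' with
    | mem_mul_mem a ha b hb =>
      change V.valuation ((a : FunctionField f) * b) ≤ _
      rw [map_mul]
      exact mul_le_mul' (hmax _ ((V.valuation_lt_one_iff _).1 ha))
        (hmax _ ((V.valuation_lt_one_iff _).1 hb))
    | add a _ b _ ha hb => exact (Valuation.map_add _ _ _).trans (max_le ha hb)
  obtain ⟨g, hg0, hg1⟩ : ∃ g : MvPolynomial (Fin 2) k,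
      (MvPolynomial.aeval ![u, v] g).eval c = 0 ∧
        (MvPolynomial.aeval ![u, v] g).derivative.eval c ≠ 0 := by
    rcases huv c with h | h
    · exact ⟨.X 0 - .C (u.eval c), by simp [MvPolynomial.algHom_C],
        by simpa [MvPolynomial.algHom_C] using h⟩
    · exact ⟨.X 1 - .C (v.eval c), by simp [MvPolynomial.algHom_C],
        by simpa [MvPolynomial.algHom_C] using h⟩
  have hgγ : w (MvPolynomial.aeval ![u, v] g) = γ := by
    obtain ⟨q, hq⟩ := dvd_iff_isRoot.2 hg0
    rw [hq, map_mul, hval q, mul_one]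
    rw [hq] at hg1
    simpa using hg1
  have hgV : V.valuation (toFunctionField f (σ.symm g)) = γ := by rw [← hgγ, hw, hrange]
  have hmem := hsing (Ideal.Quotient.mk _ (σ.symm g)) (hR _)
    ((V.valuation_lt_one_iff _).2 (hgV.trans_lt hc))
  have hle := hsq _ hmem
  change V.valuation (toFunctionField f (σ.symm g)) ≤ _ at hle
  rw [hgV] at hle
  exact absurd hle (not_le.2 (mul_lt_of_lt_one_right (zero_lt_iff.2 hγ0) hc))

end PlaneCurve

/-! ### Conclusion -/

namespace PlaneCurve

open Polynomial

variable {k : Type*} [Field k] [IsAlgClosed k] [CharZero k] {f : MvPolynomial (Fin 2) k}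
  [hf : Fact (Irreducible f)]

/-- A curve in Situation 2 is, up to automorphism, one of four parametrized curves. -/
theorem IsSituationTwo.hasForm (h : IsSituationTwo f) :
    (∃ l, (l = 0 ∨ l = -8 ∨ l = -9) ∧ HasForm f (X ^ 4 + C l * X ^ 2) (X ^ 3 - 3 * X ^ 2)) ∨
      HasForm f ((X ^ 2 - 1) * (X ^ 2 + C (-1))) ((X ^ 2 - 1) * (X + C 0)) := by
  obtain ⟨h3, h4, hsupp⟩ := newton_polygon h.onePlace h.degree_Y h.degree_X
  obtain ⟨σ, u, a, b, c, d, e, g, hu, hσ⟩ := exists_affineEquiv_eq_unfolding hsupp h3 h4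
  have hJ : jacobianIdeal (unfolding a b c d e g) =
      (jacobianIdeal f).map (σ : MvPolynomial (Fin 2) k →+* MvPolynomial (Fin 2) k) := by
    rw [← hσ, jacobianIdeal_C_mul hu, jacobianIdeal_algEquiv]
    rfl
  have hfin := finite_quotient_jacobianIdeal_unfolding a b c d e g
  -- Finiteness is known for the normal form and is carried back to `f`, where the length condition
  -- is stated.
  have : Module.Finite k (MvPolynomial (Fin 2) k ⧸ jacobianIdeal f) :=
    Module.Finite.equiv (Ideal.quotientEquivAlg _ _ σ hJ).symm.toLinearEquiv
  have hrank := ((isRankOne_of_length h.milnor_eq).algEquiv σ).C_mul hu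
  rw [hσ] at hrank
  refine hrank.hasForm_of_unfolding.imp (fun ⟨l, hl, hform⟩ => ⟨l, hl, ?_⟩) fun hform => ?_
  · exact HasForm.of_algEquiv hu (hσ ▸ hform)
  · exact HasForm.of_algEquiv hu (hσ ▸ hform)

/-- The tacnodal quartic parametrization is an immersion. -/
theorem not_isSingularBranch_of_tacnode {σ : MvPolynomial (Fin 2) k ≃ₐ[k] MvPolynomial (Fin 2) k}
    (h : IsParametrizedBy (σ f) ((X ^ 2 - 1) * (X ^ 2 + C (-1))) ((X ^ 2 - 1) * (X + C 0)))
    (V : ValuationSubring (FunctionField f)) : ¬ IsSingularBranch f V := by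
  refine not_isSingularBranch h ?_ (fun c => ?_) V
  · have : ((X ^ 2 - 1) * (X ^ 2 + C (-1)) : k[X]).natDegree = 4 := by compute_degree!
    omega
  -- The derivatives are `4 c (c^2 - 1)` and `3 c^2 - 1`, which have no common zero.
  · by_contra! hc
    obtain ⟨h1, h2⟩ := hc
    simp at h1 h2
    have h3 : (2 : k) = 0 := by grind
    exact two_ne_zero h3

end PlaneCurve

theorem lemma7p5 {k : Type*} [Field k] [IsAlgClosed k] [CharZero k]
    (f : MvPolynomial (Fin 2) k) [Fact (Irreducible f)] (hf : PlaneCurve.IsSituationTwo f) :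
    ((∃ V : ValuationSubring (PlaneCurve.FunctionField f), PlaneCurve.IsSingularBranch f V) →
      ∃ (σ : MvPolynomial (Fin 2) k ≃ₐ[k] MvPolynomial (Fin 2) k) (a : k),
        (a = 0 ∨ a = -8 ∨ a = -9) ∧
        PlaneCurve.IsParametrizedBy (σ f)
          (Polynomial.X ^ 4 + Polynomial.C a * Polynomial.X ^ 2)
          (Polynomial.X ^ 3 - 3 * Polynomial.X ^ 2)) ∧
    ((¬ ∃ V : ValuationSubring (PlaneCurve.FunctionField f), PlaneCurve.IsSingularBranch f V) →
      ∃ (σ : MvPolynomial (Fin 2) k ≃ₐ[k] MvPolynomial (Fin 2) k) (a b : k),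
        (a = -1 ∧ b ≠ 1 ∧ b ≠ -1) ∧
        PlaneCurve.IsParametrizedBy (σ f)
          ((Polynomial.X ^ 2 - 1) * (Polynomial.X ^ 2 + Polynomial.C a))
          ((Polynomial.X ^ 2 - 1) * (Polynomial.X + Polynomial.C b))) := by
  rcases hf.hasForm with ⟨l, hl, σ, h⟩ | ⟨σ, h⟩
  · refine ⟨fun _ => ⟨σ, l, hl, h⟩, fun hV => (hV ?_).elim⟩
    exact PlaneCurve.exists_isSingularBranch h
      ⟨0, Polynomial.X ^ 2 + Polynomial.C l, by rw [Polynomial.C_0]; ring⟩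
      ⟨0, Polynomial.X - 3, by rw [Polynomial.C_0]; ring⟩
  · exact ⟨fun ⟨V, hV⟩ => (PlaneCurve.not_isSingularBranch_of_tacnode h V hV).elim,
      fun _ => ⟨σ, -1, 0, ⟨rfl, by simp, by simp⟩, h⟩⟩
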